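/- All graphs are finite, simple, undirected and without isolated vertices. For a graph $G$ let $\beta(G)$ be the size of a maximum matching of $G$, let $\lambda(G)$ be the maximum of $|H|+|H'|$ over all pairs $(H,H')$ of disjoint matchings of $G$, and let $\alpha(G)$ be the largest size of a matching occurring in a pair $(H,H')$ of disjoint matchings with $|H|+|H'|=\lambda(G)$. A spanner is the graph on $10$ vertices consisting of two disjoint paths with four edges each and one further edge joining their middle vertices. An $S$-forest is a forest all of whose connected components are spanners, and an $S$-graph is a graph that has an $S$-forest as a spanning subgraph (a spanning $S$-forest of the graph). For a spanning $S$-forest $F$ of $G$, an $i$-vertex of $F$ is a vertex of degree $i$ in $F$; the base of a vertex $v$ is the $3$-vertex in the component of $v$ in $F$ that is closest to $v$ in $F$. Let $U(F)$ be the set of edges of $F$ incident to a $1$-vertex, $L(F)$ the set of edges of $F$ not in $U(F)$ that are incident to a $2$-vertex, $\Delta(G,F)$ the set of edges of $G$ joining a $1$-vertex of $F$ to its base, and $B(G,F)=E(G)\setminus(L(F)\cup U(F)\cup\Delta(G,F))$. An $L(F)$-$B(G,F)$ alternating even cycle is a closed trail of even length in $G$ (edges are distinct, vertices may repeat) whose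 edges belong alternately to $L(F)$ and to $B(G,F)$; for such a $C$, the graph formed by those edges of $C$ that lie in $B(G,F)$ is denoted $C_{B(G,F)}$. Statement. If $\beta(G)/\alpha(G)=5/4$, then $G$ is an $S$-graph, and every spanning $S$-forest $F$ of $G$ has exactly $\beta(G)-\alpha(G)$ connected components (spanners) and satisfies: (a) no $1$-vertex of $F$ is incident to an edge of $B(G,F)$; (b) if a $1$-vertex $u$ of $F$ is incident to an edge of $\Delta(G,F)$, then no $2$-vertex of $F$ adjacent to $u$ in $G$ is incident to an edge of $B(G,F)$; (c) for every $L(F)$-$B(G,F)$ alternating even cycle $C$ of $G$ containing an edge that joins two $2$-vertices of $F$, the graph $C_{B(G,F)}$ is not bipartite. -/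

import Mathlib

namespace DisjointMatchings

/-! ### Matchings and the parameters of a graph -/

/-- A matching of `G`: a set of edges of `G` no two of which share a vertex. -/
def IsMatchingOf {V : Type*} (G : SimpleGraph V) (H : Finset (Sym2 V)) : Prop :=
  (∀ e ∈ H, e ∈ G.edgeSet) ∧ ∀ e ∈ H, ∀ f ∈ H, e ≠ f → ∀ v, v ∈ e → v ∉ f

/-- A pair of disjoint matchings of `G`. -/
def IsDisjointMatchingPair {V : Type*} (G : SimpleGraph V) (H H' : Finset (Sym2 V)) : Prop :=
  IsMatchingOf G H ∧ IsMatchingOf G H' ∧ Disjoint H H'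

/-- `β(G)`: the size of a maximum matching. -/
noncomputable def beta {V : Type*} (G : SimpleGraph V) : ℕ :=
  sSup {n | ∃ H, IsMatchingOf G H ∧ n = H.card}

/-- `λ(G)`: the largest total size of a pair of disjoint matchings. -/
noncomputable def lam {V : Type*} (G : SimpleGraph V) : ℕ :=
  sSup {n | ∃ H H', IsDisjointMatchingPair G H H' ∧ n = H.card + H'.card}

/-- `α(G)`: the size of the largest matching that occurs in a pair of disjoint matchings
of total size `λ(G)`. -/
noncomputable def alpha {V : Type*} (G : SimpleGraph V) : ℕ :=
  sSup {n | ∃ H H', IsDisjointMatchingPair G H H' ∧ H.card + H'.card = lam G ∧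
    (n = H.card ∨ n = H'.card)}

/-! ### Spanners, S-forests and S-graphs -/

/-- The spanner: two disjoint paths `0 1 2 3 4` and `5 6 7 8 9` of length four, whose
central vertices `2` and `7` are joined by an edge. -/
def spanner : SimpleGraph (Fin 10) :=
  SimpleGraph.fromEdgeSet
    {s(0, 1), s(1, 2), s(2, 3), s(3, 4), s(5, 6), s(6, 7), s(7, 8), s(8, 9), s(2, 7)}

/-- An S-forest: a forest whose connected components are spanners. -/
def IsSForest {V : Type*} (F : SimpleGraph V) : Prop :=
  F.IsAcyclic ∧ ∀ c : F.ConnectedComponent, Nonempty (c.toSimpleGraph ≃g spanner)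

/-- `F` is a spanning S-forest of `G`. Graphs on the same vertex type with `F ≤ G` are exactly
the spanning subgraphs of `G`. -/
def IsSpanningSForest {V : Type*} (G F : SimpleGraph V) : Prop :=
  F ≤ G ∧ IsSForest F

/-- An S-graph: a graph that has a spanning S-forest. -/
def IsSGraph {V : Type*} (G : SimpleGraph V) : Prop :=
  ∃ F : SimpleGraph V, IsSpanningSForest G F

/-- `v` is an `i`-vertex of `F`: its degree in `F` (equivalently, in its connected component)
is `i`. -/
def IsIVertex {V : Type*} (F : SimpleGraph V) (i : ℕ) (v : V) : Prop :=
  (F.neighborSet v).ncard = i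

/-- `w` is the base of `v`: a `3`-vertex in the connected component of `v` that is closest
to `v`. -/
def IsBase {V : Type*} (F : SimpleGraph V) (v w : V) : Prop :=
  IsIVertex F 3 w ∧ F.Reachable v w ∧
    ∀ w', IsIVertex F 3 w' → F.Reachable v w' → F.dist v w ≤ F.dist v w'

/-- `U(F)`: the edges of `F` incident to a `1`-vertex. -/
def edgesU {V : Type*} (F : SimpleGraph V) : Set (Sym2 V) :=
  {e | e ∈ F.edgeSet ∧ ∃ v ∈ e, IsIVertex F 1 v}

/-- `L(F)`: the edges of `F` outside `U(F)` incident to a `2`-vertex. -/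
def edgesL {V : Type*} (F : SimpleGraph V) : Set (Sym2 V) :=
  {e | e ∈ F.edgeSet ∧ e ∉ edgesU F ∧ ∃ v ∈ e, IsIVertex F 2 v}

/-- `Δ(G, F)`: the edges of `G` that join a `1`-vertex of `F` to its base. -/
def edgesDelta {V : Type*} (G F : SimpleGraph V) : Set (Sym2 V) :=
  {e | e ∈ G.edgeSet ∧ ∃ u w, e = s(u, w) ∧ IsIVertex F 1 u ∧ IsBase F u w}

/-- `B(G, F) = E(G) \ (L(F) ∪ U(F) ∪ Δ(G, F))`. -/
def edgesB {V : Type*} (G F : SimpleGraph V) : Set (Sym2 V) :=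
  G.edgeSet \ (edgesL F ∪ edgesU F ∪ edgesDelta G F)

/-! ### Alternating even cycles -/

/-- The edges of the walk alternate between `A \ B` and `B \ A`, starting with `A \ B`. -/
def AlternatesFrom {V : Type*} {G : SimpleGraph V} (A B : Set (Sym2 V)) {u v : V}
    (p : G.Walk u v) : Prop :=
  ∀ (i : ℕ) (hi : i < p.edges.length),
    (Even i → p.edges[i] ∈ A \ B) ∧ (¬ Even i → p.edges[i] ∈ B \ A)

/-- An `A`-`B` alternating even cycle of `G`. A cycle is a closed trail: edges do not repeat,
but vertices may. -/
def IsAlternatingEvenCycle {V : Type*} {G : SimpleGraph V} (A B : Set (Sym2 V)) {v : V}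
    (C : G.Walk v v) : Prop :=
  C.IsTrail ∧ Even C.length ∧ (AlternatesFrom A B C ∨ AlternatesFrom B A C)

/-- The graph `C_B` formed by the edges of `C` that belong to `B`. (The remaining vertices of `G`
are kept as isolated vertices, which does not affect bipartiteness.) -/
def edgePart {V : Type*} {G : SimpleGraph V} (B : Set (Sym2 V)) {v : V} (C : G.Walk v v) :
    SimpleGraph V :=
  SimpleGraph.fromEdgeSet {e | e ∈ C.edges ∧ e ∈ B}

/-! ### The three conditions -/

/-- (a) `1`-vertices of `F` are not incident to any edge of `B(G, F)`. -/
def ConditionA {V : Type*} (G F : SimpleGraph V) : Prop :=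
  ∀ u, IsIVertex F 1 u → ∀ e ∈ edgesB G F, u ∉ e

/-- (b) if a `1`-vertex `u` of `F` is incident to an edge of `Δ(G, F)`, then a `2`-vertex of `F`
adjacent to `u` is not incident to any edge of `B(G, F)`. -/
def ConditionB {V : Type*} (G F : SimpleGraph V) : Prop :=
  ∀ u, IsIVertex F 1 u → (∃ e ∈ edgesDelta G F, u ∈ e) →
    ∀ v, IsIVertex F 2 v → G.Adj u v → ∀ e ∈ edgesB G F, v ∉ e

/-- (c) for every `L(F)`-`B(G, F)` alternating even cycle `C` of `G` containing a `2`-`2` edge,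
the graph `C_{B(G, F)}` is not bipartite. -/
def ConditionC {V : Type*} (G F : SimpleGraph V) : Prop :=
  ∀ (v : V) (C : G.Walk v v), IsAlternatingEvenCycle (edgesL F) (edgesB G F) C →
    (∃ x y, s(x, y) ∈ C.edges ∧ IsIVertex F 2 x ∧ IsIVertex F 2 y) →
    ¬ (edgePart (edgesB G F) C).IsBipartite

end DisjointMatchings

/-! ### Pairs of disjoint matchings carried by a vertex set, and their assembly from paths. -/

namespace DisjointMatchings

variable {V : Type*}

/-! The proof has two halves, linked by the notions `PathSystem` and `Balanced`.

Extraction of a path system. Matchings are encoded as involutions whose fixed points are the missed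
vertices, so alternating paths are iterates of two maps. Fix a maximum matching `m`. Among the pairs
`(h, h')` attaining λ with `h` of size α, take one sharing as many edges with `m` as possible
(`IsBest`). At a vertex `u` missed by `h` but covered by `m`, the edge of `m` must lie in `h'`
(`IsBest.eq_of_fixed`); otherwise moving it into `h` would improve the pair. The `h'`-`h`
alternating path from `u` therefore starts with an edge of `m`. It cannot end at another vertex
missed by `h`, since exchanging `h` and `h'` along it would enlarge `h`. Hence the initial segments
from different starts are disjoint, and each uses four vertices covered by `h`, or two if the path
is short. Each short path costs a vertex covered by `h` but not by `m`. Counting gives β ≤ 5α/4.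
Equality forces every path to have exactly four edges, the paths to contain all vertices covered by
`h`, and `m` to join their centres in pairs (`IsBest.extremal`, `IsBest.exists_pathSystem`). With n
paths, α = 2n and λ ≤ 4n; this is recorded as `Balanced G n`.

Consequences of balance. Given any path system with n paths, reroute some k of them into
vertex-disjoint paths with at least 4k edges in total, one of which has an odd number of edges.
Splitting all paths into two matchings then gives a pair of total at least 4n with a member larger
than 2n, which contradicts balance (`PathSystem.le_of_paths`). Such reroutings show that the system
covers every vertex (`φ_surjective`), so `G` is an S-graph. They also restrict the neighbours of
leaves (`eq_of_adj_leaf`), which gives (a) and (b). For (c), exchanging L-edges for B-edges along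
the cycle preserves all degrees. If C_B were bipartite, the resulting edge set would split into two
matchings with a three-edge path as a component, again against balance (`Spans.conditionC`).

Balance mentions only n, and any spanning S-forest yields a path system with |V| = 5n. So the
conclusions hold for every spanning S-forest, and not only for the extracted one. -/

/-- `G` has a pair of disjoint matchings of sizes `p` and `q` that only uses vertices of `S`. -/
def PairOn (G : SimpleGraph V) (S : Set V) (p q : ℕ) : Prop :=
  ∃ H H' : Finset (Sym2 V), IsDisjointMatchingPair G H H' ∧
    (∀ e ∈ H, ∀ v ∈ e, v ∈ S) ∧ (∀ e ∈ H', ∀ v ∈ e, v ∈ S) ∧ H.card = p ∧ H'.card = q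

theorem PairOn.symm {G : SimpleGraph V} {S : Set V} {p q : ℕ} (h : PairOn G S p q) :
    PairOn G S q p := by
  obtain ⟨H, H', ⟨h1, h2, h3⟩, h4, h5, h6, h7⟩ := h
  exact ⟨H', H, ⟨h2, h1, h3.symm⟩, h5, h4, h7, h6⟩

theorem PairOn.empty (G : SimpleGraph V) (S : Set V) : PairOn G S 0 0 :=
  ⟨∅, ∅, by simp [IsDisjointMatchingPair, IsMatchingOf]⟩

theorem IsMatchingOf.union [DecidableEq V] {G : SimpleGraph V} {S T : Set V}
    {H K : Finset (Sym2 V)} (hH : IsMatchingOf G H) (hK : IsMatchingOf G K)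
    (hS : ∀ e ∈ H, ∀ v ∈ e, v ∈ S) (hT : ∀ e ∈ K, ∀ v ∈ e, v ∈ T) (hST : Disjoint S T) :
    IsMatchingOf G (H ∪ K) := by
  rw [Set.disjoint_left] at hST
  refine ⟨fun e he => ?_, fun e he f hf hef v hv hv' => ?_⟩
  · rcases Finset.mem_union.1 he with he | he
    exacts [hH.1 e he, hK.1 e he]
  · rcases Finset.mem_union.1 he with he | he <;> rcases Finset.mem_union.1 hf with hf | hf
    · exact hH.2 e he f hf hef v hv hv'
    · exact hST (hS e he v hv) (hT f hf v hv')
    · exact hST (hS f hf v hv') (hT e he v hv)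
    · exact hK.2 e he f hf hef v hv hv'

theorem disjoint_of_vertices_disjoint {S T : Set V} {H K : Finset (Sym2 V)}
    (hS : ∀ e ∈ H, ∀ v ∈ e, v ∈ S) (hT : ∀ e ∈ K, ∀ v ∈ e, v ∈ T) (hST : Disjoint S T) :
    Disjoint H K := by
  rw [Set.disjoint_left] at hST
  rw [Finset.disjoint_left]
  intro e he he'
  induction e with
  | _ x y => exact hST (hS _ he x (by simp)) (hT _ he' x (by simp))

theorem PairOn.union {G : SimpleGraph V} {S T : Set V} {p q p' q' : ℕ} (h : PairOn G S p q)
    (k : PairOn G T p' q') (hST : Disjoint S T) : PairOn G (S ∪ T) (p + p') (q + q') := by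
  classical
  obtain ⟨H, H', ⟨h1, h2, h3⟩, h4, h5, rfl, rfl⟩ := h
  obtain ⟨K, K', ⟨k1, k2, k3⟩, k4, k5, rfl, rfl⟩ := k
  refine ⟨H ∪ K, H' ∪ K', ⟨h1.union k1 h4 k4 hST, h2.union k2 h5 k5 hST, ?_⟩, ?_, ?_, ?_, ?_⟩
  · rw [Finset.disjoint_union_left, Finset.disjoint_union_right, Finset.disjoint_union_right]
    exact ⟨⟨h3, disjoint_of_vertices_disjoint h4 k5 hST⟩,
      disjoint_of_vertices_disjoint k4 h5 hST.symm, k3⟩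
  · intro e he v hv
    rcases Finset.mem_union.1 he with he | he
    exacts [Or.inl (h4 e he v hv), Or.inr (k4 e he v hv)]
  · intro e he v hv
    rcases Finset.mem_union.1 he with he | he
    exacts [Or.inl (h5 e he v hv), Or.inr (k5 e he v hv)]
  · exact Finset.card_union_of_disjoint (disjoint_of_vertices_disjoint h4 k4 hST)
  · exact Finset.card_union_of_disjoint (disjoint_of_vertices_disjoint h5 k5 hST)

/-- The edges of a path split into two matchings. -/
theorem PairOn.path {G : SimpleGraph V} (l : List V) (hl : l.Nodup) (hc : l.IsChain G.Adj) :
    PairOn G {v | v ∈ l} (l.length / 2) ((l.length - 1) / 2) := by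
  classical
  -- The induction needs the second matching to miss the head of the path: the next edge is then
  -- added to it, and the two matchings change roles.
  suffices h : ∃ H H' : Finset (Sym2 V), IsDisjointMatchingPair G H H' ∧
      (∀ e ∈ H, ∀ v ∈ e, v ∈ l) ∧ (∀ e ∈ H', ∀ v ∈ e, v ∈ l) ∧ H.card = l.length / 2 ∧
      H'.card = (l.length - 1) / 2 ∧ ∀ e ∈ H', ∀ v ∈ l.head?, v ∉ e by
    obtain ⟨H, H', h1, h2, h3, h4, h5, -⟩ := h
    exact ⟨H, H', h1, h2, h3, h4, h5⟩
  induction l with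
  | nil => exact ⟨∅, ∅, by simp [IsDisjointMatchingPair, IsMatchingOf]⟩
  | cons w l ih =>
    cases l with
    | nil => exact ⟨∅, ∅, by simp [IsDisjointMatchingPair, IsMatchingOf]⟩
    | cons v l =>
      obtain ⟨H, H', ⟨h1, h2, h3⟩, h4, h5, h6, h7, h8⟩ := ih hl.of_cons hc.tail
      have hw : w ∉ v :: l := (List.nodup_cons.1 hl).1
      have hwv : G.Adj w v := by simpa using (List.isChain_cons_cons.1 hc).1
      have hnH' : ∀ e ∈ H', w ∉ e := fun e he hv => hw (h5 e he w hv)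
      have hnH : ∀ e ∈ H, w ∉ e := fun e he hv => hw (h4 e he w hv)
      have h8' : ∀ e ∈ H', v ∉ e := fun e he => h8 e he v (by simp)
      have hin' : s(w, v) ∉ H' := fun h => hnH' _ h (by simp)
      have hin : s(w, v) ∉ H := fun h => hnH _ h (by simp)
      refine ⟨insert s(w, v) H', H, ⟨⟨?_, ?_⟩, h1, ?_⟩, ?_, ?_, ?_, ?_, ?_⟩
      · intro e he
        rcases Finset.mem_insert.1 he with rfl | he
        exacts [hwv, h2.1 e he]
      · intro e he f hf hef x hx hx'
        rcases Finset.mem_insert.1 he with rfl | he₁ <;>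
          rcases Finset.mem_insert.1 hf with rfl | hf₁
        · exact hef rfl
        · rcases Sym2.mem_iff.1 hx with h | h
          exacts [hnH' f hf₁ (h ▸ hx'), h8' f hf₁ (h ▸ hx')]
        · rcases Sym2.mem_iff.1 hx' with h | h
          exacts [hnH' e he₁ (h ▸ hx), h8' e he₁ (h ▸ hx)]
        · exact h2.2 e he₁ f hf₁ hef x hx hx'
      · rw [Finset.disjoint_insert_left]
        exact ⟨hin, h3.symm⟩
      · intro e he x hx
        rcases Finset.mem_insert.1 he with rfl | he
        · rcases Sym2.mem_iff.1 hx with rfl | rfl <;> simp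
        · exact List.mem_cons_of_mem _ (h5 e he x hx)
      · exact fun e he x hx => List.mem_cons_of_mem _ (h4 e he x hx)
      · rw [Finset.card_insert_of_notMem hin', h7]
        simp only [List.length_cons]; omega
      · rw [h6]; simp
      · intro e he x hx
        simp only [List.head?_cons, Option.mem_some_iff] at hx
        exact hx ▸ hnH e he

/-- A family of vertex-disjoint paths gives a pair of disjoint matchings. -/
theorem PairOn.paths {G : SimpleGraph V} (L : List (List V)) (hL : L.flatten.Nodup)
    (hc : ∀ l ∈ L, l.IsChain G.Adj) :
    PairOn G {v | v ∈ L.flatten} (L.map fun l => l.length / 2).sum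
      (L.map fun l => (l.length - 1) / 2).sum := by
  induction L with
  | nil => exact PairOn.empty _ _
  | cons l L ih =>
    rw [List.flatten_cons, List.nodup_append'] at hL
    have := (PairOn.path l hL.1 (hc l (by simp))).union
      (ih hL.2.1 fun l hl => hc l (List.mem_cons_of_mem _ hl))
      (Set.disjoint_left.2 fun v h h' => hL.2.2 h h')
    convert this using 1
    · ext v; simp
    · simp
    · simp

/-! ### Path systems and the balance condition. -/

/-- A system of paths `φ a 0, …, φ a 4` with four edges, paired by joining their centres. -/
structure PathSystem (G : SimpleGraph V) (A : Type*) where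
  φ : A → Fin 5 → V
  τ : A → A
  inj : ∀ a b i j, φ a i = φ b j → a = b ∧ i = j
  invol : ∀ a, τ (τ a) = a
  ne : ∀ a, τ a ≠ a
  adj01 : ∀ a, G.Adj (φ a 0) (φ a 1)
  adj12 : ∀ a, G.Adj (φ a 1) (φ a 2)
  adj23 : ∀ a, G.Adj (φ a 2) (φ a 3)
  adj34 : ∀ a, G.Adj (φ a 3) (φ a 4)
  adjC : ∀ a, G.Adj (φ a 2) (φ (τ a) 2)

/-- A pair of disjoint matchings of total size at least `4 n` has no member larger than `2 n`. -/
def Balanced (G : SimpleGraph V) (n : ℕ) : Prop :=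
  ∀ H H', IsDisjointMatchingPair G H H' → 4 * n ≤ H.card + H'.card → H.card ≤ 2 * n

namespace PathSystem

variable {A : Type*} {G : SimpleGraph V} (P : PathSystem G A)

theorem φ_eq_iff {a b : A} {i j : Fin 5} : P.φ a i = P.φ b j ↔ a = b ∧ i = j :=
  ⟨P.inj a b i j, by rintro ⟨rfl, rfl⟩; rfl⟩

theorem pairOn_finset (J : Finset A) :
    PairOn G {v | ∃ a ∈ J, ∃ i, v = P.φ a i} (2 * J.card) (2 * J.card) := by
  classical
  induction J using Finset.induction_on with
  | empty => simpa using PairOn.empty _ _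
  | insert a J ha ih =>
    have h1 := PairOn.path (G := G) [P.φ a 0, P.φ a 1, P.φ a 2, P.φ a 3, P.φ a 4]
      (by simp [P.φ_eq_iff]) (by simp [P.adj01, P.adj12, P.adj23, P.adj34])
    have h2 := h1.union ih (by
      rw [Set.disjoint_left]
      rintro v hv ⟨b, hb, i, rfl⟩
      simp only [List.mem_cons, List.not_mem_nil, or_false, Set.mem_ofPred_eq, P.φ_eq_iff] at hv
      apply ha
      grind)
    obtain ⟨H, H', h3, h4, h5, h6, h7⟩ := h2
    have key : ∀ v, v ∈ ({v | v ∈ [P.φ a 0, P.φ a 1, P.φ a 2, P.φ a 3, P.φ a 4]} ∪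
        {v | ∃ a ∈ J, ∃ i, v = P.φ a i} : Set V) → ∃ b ∈ insert a J, ∃ i, v = P.φ b i := by
      rintro v (hv | ⟨b, hb, i, rfl⟩)
      · simp only [List.mem_cons, List.not_mem_nil, or_false, Set.mem_ofPred_eq] at hv
        exact ⟨a, by simp, by grind⟩
      · exact ⟨b, by simp [hb], i, rfl⟩
    refine ⟨H, H', h3, fun e he v hv => key v (h4 e he v hv),
      fun e he v hv => key v (h5 e he v hv), ?_, ?_⟩
    · rw [h6, Finset.card_insert_of_notMem ha]; simp; omega
    · rw [h7, Finset.card_insert_of_notMem ha]; simp; omega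

/-- Replacing the paths with index in `I` by the paths `L` cannot beat the balance. -/
theorem le_of_paths [Fintype A] (hB : Balanced G (Fintype.card A)) (I : Finset A)
    (L : List (List V)) (hL : L.flatten.Nodup) (hc : ∀ l ∈ L, l.IsChain G.Adj)
    (hI : ∀ a, ∀ i, P.φ a i ∈ L.flatten → a ∈ I)
    (hsum : 4 * I.card ≤ (L.map fun l => l.length / 2).sum +
      (L.map fun l => (l.length - 1) / 2).sum) :
    (L.map fun l => l.length / 2).sum ≤ 2 * I.card := by
  classical
  have h1 := PairOn.paths L hL hc
  obtain ⟨H, H', h3, h4, h5, h6, h7⟩ := h1.union (P.pairOn_finset Iᶜ) (by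
    rw [Set.disjoint_left]
    rintro v hv ⟨b, hb, i, rfl⟩
    exact (Finset.mem_compl.1 hb) (hI b i hv))
  have h8 := hB H H' h3
  have h9 : I.card + Iᶜ.card = Fintype.card A := Finset.card_add_card_compl I
  omega

end PathSystem
end DisjointMatchings

/-! ### Rerouting arguments: covering all vertices, and the neighbours of leaves. -/

namespace DisjointMatchings
namespace PathSystem

variable {V : Type*} {A : Type*} {G : SimpleGraph V} (P : PathSystem G A)

/-- Reverse the path with index `a`. -/
def flip [DecidableEq A] (a : A) : PathSystem G A where
  φ b i := if b = a then P.φ b i.rev else P.φ b i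
  τ := P.τ
  inj b c i j h := by
    split_ifs at h <;> obtain ⟨rfl, h⟩ := P.inj _ _ _ _ h <;> simp_all
  invol := P.invol
  ne := P.ne
  adj01 b := by
    split_ifs
    exacts [(P.adj34 b).symm, P.adj01 b]
  adj12 b := by
    split_ifs
    exacts [(P.adj23 b).symm, P.adj12 b]
  adj23 b := by
    split_ifs
    exacts [(P.adj12 b).symm, P.adj23 b]
  adj34 b := by
    split_ifs
    exacts [(P.adj01 b).symm, P.adj34 b]
  adjC b := by
    have h : Fin.rev (2 : Fin 5) = 2 := rfl
    simpa [h] using P.adjC b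

theorem flip_φ_self [DecidableEq A] (a : A) (i : Fin 5) : (P.flip a).φ a i = P.φ a i.rev := by
  simp [flip]

theorem flip_φ_of_ne [DecidableEq A] {a b : A} (h : b ≠ a) (i : Fin 5) :
    (P.flip a).φ b i = P.φ b i := by
  simp [flip, h]

/-- Exchange the first two vertices of the path with index `a`. -/
def swap [DecidableEq A] (a : A) (h : G.Adj (P.φ a 0) (P.φ a 2)) : PathSystem G A where
  φ b i := if b = a then P.φ b (Equiv.swap 0 1 i) else P.φ b i
  τ := P.τ
  inj b c i j h := by
    split_ifs at h <;> obtain ⟨rfl, h⟩ := P.inj _ _ _ _ h <;> simp_all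
  invol := P.invol
  ne := P.ne
  adj01 b := by
    split_ifs
    exacts [(P.adj01 b).symm, P.adj01 b]
  adj12 b := by
    split_ifs with hb
    exacts [hb ▸ h, P.adj12 b]
  adj23 b := by
    split_ifs
    exacts [P.adj23 b, P.adj23 b]
  adj34 b := by
    split_ifs
    exacts [P.adj34 b, P.adj34 b]
  adjC b := by
    have h : (Equiv.swap 0 1 (2 : Fin 5)) = 2 := rfl
    simpa [h] using P.adjC b

variable [Fintype A]

/-- Each case attaches the uncovered vertex `z` to the system and applies `le_of_paths`. The listed
paths have at least four edges per replaced path, and at least one has an even number of vertices.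
Such a path contributes one more edge to the first matching than to the second, while no path
contributes fewer; so the first matching exceeds its bound. -/
theorem φ_surjective (hB : Balanced G (Fintype.card A)) (hG : ∀ v, ∃ w, G.Adj v w) (z : V) :
    ∃ a i, z = P.φ a i := by
  classical
  by_contra! hz
  obtain ⟨w, hw⟩ := hG z
  by_cases hw' : ∃ a i, w = P.φ a i
  · obtain ⟨a, i, rfl⟩ := hw'
    have h0 : ∀ Q : PathSystem G A, (∀ b j, z ≠ Q.φ b j) → ¬ G.Adj z (Q.φ a 0) := by
      intro Q hQ h
      have := Q.le_of_paths hB {a} [[z, Q.φ a 0, Q.φ a 1, Q.φ a 2, Q.φ a 3, Q.φ a 4]]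
        (by simp [φ_eq_iff, hQ]) (by simp [adj01, adj12, adj23, adj34, h])
        (by intro b i; simp [φ_eq_iff, (hQ _ _).symm]; tauto) (by simp)
      simp at this
    have h1 : ∀ Q : PathSystem G A, (∀ b j, z ≠ Q.φ b j) → ¬ G.Adj z (Q.φ a 1) := by
      intro Q hQ h
      have hτ := Q.ne a
      -- One path does not suffice here: `z` becomes the end of a two-edge path, and the rest of
      -- path `a` is continued through the edge between the centres.
      have := Q.le_of_paths hB {a, Q.τ a}
        [[Q.φ (Q.τ a) 0, Q.φ (Q.τ a) 1, Q.φ (Q.τ a) 2, Q.φ a 2, Q.φ a 3, Q.φ a 4],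
          [Q.φ a 0, Q.φ a 1, z], [Q.φ (Q.τ a) 3, Q.φ (Q.τ a) 4]]
        (by simp [φ_eq_iff, hQ, (hQ _ _).symm, hτ, hτ.symm])
        (by simp [adj01, adj12, adj23, adj34, h.symm, (Q.adjC a).symm])
        (by intro b i; simp [φ_eq_iff, (hQ _ _).symm]; tauto)
        (by simp [Finset.card_pair hτ.symm])
      simp [Finset.card_pair hτ.symm] at this
    have h2 : ¬ G.Adj z (P.φ a 2) := by
      intro h
      have := P.le_of_paths hB {a} [[z, P.φ a 2, P.φ a 1, P.φ a 0], [P.φ a 3, P.φ a 4]]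
        (by simp [φ_eq_iff, hz]) (by simp [(P.adj01 a).symm, (P.adj12 a).symm, adj34, h])
        (by intro b i; simp [φ_eq_iff, (hz _ _).symm]; tauto) (by simp)
      simp at this
    -- Reversing path `a` reduces positions 3 and 4 to positions 1 and 0; this is why the exclusions
    -- above are stated for every system `Q`.
    have hQ : ∀ b j, z ≠ (P.flip a).φ b j := by
      intro b j
      unfold flip
      dsimp only
      split_ifs <;> exact hz _ _
    match i with
    | 0 => exact h0 P hz hw
    | 1 => exact h1 P hz hw
    | 2 => exact h2 hw
    | 3 => exact h1 _ hQ (by rwa [flip_φ_self])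
    | 4 => exact h0 _ hQ (by rwa [flip_φ_self])
  · push Not at hw'
    have := P.le_of_paths hB ∅ [[z, w]] (by simp [hw.ne]) (by simp [hw])
      (by intro b i; simp [(hz b i).symm, (hw' b i).symm]) (by simp)
    simp at this

/-- Any other edge at a leaf would allow a rerouting with four edges per replaced path and some path
with an odd number of edges. Where path `a` or `b` alone gives too few edges, the edge from its
centre to that of its partner makes up the loss. -/
theorem eq_of_adj_leaf (hB : Balanced G (Fintype.card A)) (hG : ∀ v, ∃ w, G.Adj v w) (a : A)
    {w : V} (hw : G.Adj (P.φ a 0) w) : w = P.φ a 1 ∨ w = P.φ a 2 := by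
  classical
  obtain ⟨b, i, rfl⟩ := P.φ_surjective hB hG w
  by_cases hab : b = a
  · subst hab
    have hτ := P.ne b
    match i with
    | 0 => exact (G.loopless.irrefl _ hw).elim
    | 1 => exact Or.inl rfl
    | 2 => exact Or.inr rfl
    | 3 =>
      have := P.le_of_paths hB {b, P.τ b}
        [[P.φ b 4, P.φ b 3, P.φ b 0, P.φ b 1, P.φ b 2, P.φ (P.τ b) 2, P.φ (P.τ b) 1,
          P.φ (P.τ b) 0], [P.φ (P.τ b) 3, P.φ (P.τ b) 4]]
        (by simp [φ_eq_iff, hτ.symm])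
        (by simp [adj01, adj12, (P.adj01 _).symm, (P.adj12 _).symm, adj34, (P.adj34 _).symm,
          hw.symm, adjC])
        (by intro b i; simp [φ_eq_iff]; tauto)
        (by simp [Finset.card_pair hτ.symm])
      simp [Finset.card_pair hτ.symm] at this
    | 4 =>
      have := P.le_of_paths hB {b, P.τ b}
        [[P.φ b 1, P.φ b 0, P.φ b 4, P.φ b 3, P.φ b 2, P.φ (P.τ b) 2, P.φ (P.τ b) 1,
          P.φ (P.τ b) 0], [P.φ (P.τ b) 3, P.φ (P.τ b) 4]]
        (by simp [φ_eq_iff, hτ.symm])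
        (by simp [(P.adj01 _).symm, (P.adj12 _).symm, adj34, (P.adj34 _).symm, (P.adj23 _).symm,
          hw, adjC])
        (by intro b i; simp [φ_eq_iff]; tauto)
        (by simp [Finset.card_pair hτ.symm])
      simp [Finset.card_pair hτ.symm] at this
  · exfalso
    have h0 : ∀ Q : PathSystem G A, ¬ G.Adj (Q.φ a 0) (Q.φ b 0) := by
      intro Q h
      have := Q.le_of_paths hB {a, b}
        [[Q.φ a 4, Q.φ a 3, Q.φ a 2, Q.φ a 1, Q.φ a 0, Q.φ b 0, Q.φ b 1, Q.φ b 2, Q.φ b 3,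
          Q.φ b 4]]
        (by simp [φ_eq_iff, Ne.symm hab])
        (by simp [adj01, adj12, adj23, adj34, (Q.adj01 _).symm, (Q.adj12 _).symm,
          (Q.adj34 _).symm, (Q.adj23 _).symm, h])
        (by intro b i; simp [φ_eq_iff]; tauto)
        (by simp [Finset.card_pair (Ne.symm hab)])
      simp [Finset.card_pair (Ne.symm hab)] at this
    have h2 : ¬ G.Adj (P.φ a 0) (P.φ b 2) := by
      intro h
      have := P.le_of_paths hB {a, b}
        [[P.φ a 4, P.φ a 3, P.φ a 2, P.φ a 1, P.φ a 0, P.φ b 2, P.φ b 3, P.φ b 4],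
          [P.φ b 0, P.φ b 1]]
        (by simp [φ_eq_iff, Ne.symm hab])
        (by simp [adj01, adj23, adj34, (P.adj01 _).symm, (P.adj12 _).symm,
          (P.adj34 _).symm, (P.adj23 _).symm, h])
        (by intro b i; simp [φ_eq_iff]; tauto)
        (by simp [Finset.card_pair (Ne.symm hab)])
      simp [Finset.card_pair (Ne.symm hab)] at this
    have h1 : ∀ Q : PathSystem G A, ¬ G.Adj (Q.φ a 0) (Q.φ b 1) := by
      intro Q h
      -- If `a` is itself the partner of `b`, two paths are rerouted; otherwise the partner of `b`
      -- is a third path.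
      by_cases hτ : Q.τ b = a
      · have hadj := Q.adjC b
        rw [hτ] at hadj
        have := Q.le_of_paths hB {a, b}
          [[Q.φ a 4, Q.φ a 3, Q.φ a 2, Q.φ b 2, Q.φ b 3, Q.φ b 4],
            [Q.φ a 1, Q.φ a 0, Q.φ b 1, Q.φ b 0]]
          (by simp [φ_eq_iff, Ne.symm hab, hab])
          (by simp [adj23, adj34, (Q.adj01 _).symm, (Q.adj34 _).symm, (Q.adj23 _).symm, h,
            hadj.symm])
          (by intro b i; simp [φ_eq_iff]; tauto)
          (by simp [Finset.card_pair (Ne.symm hab)])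
        simp [Finset.card_pair (Ne.symm hab)] at this
      · have hτ' := Q.ne b
        have hcard : ({a, b, Q.τ b} : Finset A).card = 3 :=
          Finset.card_eq_three.2 ⟨_, _, _, Ne.symm hab, Ne.symm hτ, hτ'.symm, rfl⟩
        have := Q.le_of_paths hB {a, b, Q.τ b}
          [[Q.φ a 4, Q.φ a 3, Q.φ a 2, Q.φ a 1, Q.φ a 0, Q.φ b 1, Q.φ b 0],
            [Q.φ b 4, Q.φ b 3, Q.φ b 2, Q.φ (Q.τ b) 2, Q.φ (Q.τ b) 3, Q.φ (Q.τ b) 4],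
            [Q.φ (Q.τ b) 0, Q.φ (Q.τ b) 1]]
          (by simp [φ_eq_iff, Ne.symm hab, Ne.symm hτ, hτ'.symm])
          (by simp [adj01, adj23, adj34, (Q.adj01 _).symm, (Q.adj12 _).symm,
            (Q.adj34 _).symm, (Q.adj23 _).symm, h, adjC])
          (by intro b i; simp [φ_eq_iff]; tauto)
          (by simp [hcard])
        simp [hcard] at this
    have hflip : ∀ i, (P.flip b).φ a i = P.φ a i := fun i => P.flip_φ_of_ne (Ne.symm hab) i
    match i with
    | 0 => exact h0 P hw
    | 1 => exact h1 P hw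
    | 2 => exact h2 hw
    | 3 => exact h1 (P.flip b) (by rwa [flip_φ_self, hflip])
    | 4 => exact h0 (P.flip b) (by rwa [flip_φ_self, hflip])

/-- With the chord from position 0 to position 2, positions 0 and 1 are interchangeable, so `P.φ a
1` is a leaf of the system `P.swap a h`. -/
theorem eq_of_adj_of_triangle (hB : Balanced G (Fintype.card A)) (hG : ∀ v, ∃ w, G.Adj v w)
    (a : A) (h : G.Adj (P.φ a 0) (P.φ a 2)) {w : V} (hw : G.Adj (P.φ a 1) w) :
    w = P.φ a 0 ∨ w = P.φ a 2 := by
  classical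
  have := (P.swap a h).eq_of_adj_leaf hB hG a (w := w) (by simpa [swap] using hw)
  have h2 : (Equiv.swap 0 1 (2 : Fin 5)) = 2 := rfl
  simpa [swap, h2] using this

end PathSystem
end DisjointMatchings

/-! ### Splitting a bipartite edge set of maximum degree two into two matchings. -/

namespace DisjointMatchings

/-- Two fixed-point-free involutions have a common proper `2`-colouring of their orbits. -/
theorem exists_coloring_of_free_involutions {X : Type*} (p n : Equiv.Perm X)
    (hp : ∀ x, p (p x) = x) (hn : ∀ x, n (n x) = x) (hp' : ∀ x, p x ≠ x) (hn' : ∀ x, n x ≠ x) :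
    ∃ g : X → Bool, (∀ x, g (p x) = !g x) ∧ ∀ x, g (n x) = !g x := by
  classical
  set r := p * n with hr
  have hpr : p * r = r⁻¹ * p := by
    ext x
    have : r⁻¹ (p x) = n x := by rw [Equiv.Perm.inv_eq_iff_eq, hr, Equiv.Perm.mul_apply, hn]
    rw [Equiv.Perm.mul_apply r⁻¹, this, hr, Equiv.Perm.mul_apply, Equiv.Perm.mul_apply, hp]
  have hprk : ∀ k : ℤ, p * r ^ k = (r ^ k)⁻¹ * p := by
    intro k
    have h : SemiconjBy p r r⁻¹ := hpr
    have := h.zpow_right k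
    rw [inv_zpow] at this
    exact this
  have hprk' : ∀ (k : ℤ) x, p ((r ^ k) x) = (r ^ k)⁻¹ (p x) := fun k x => by
    rw [← Equiv.Perm.mul_apply, hprk, Equiv.Perm.mul_apply]
  -- Conjugation by `p` inverts `r`. If `r ^ k` sends `x` to `p x`, the midpoint `(r ^ j) x` is
  -- fixed by `p` when `k = 2j` and by `n` when `k = 2j + 1`.
  have hfree : ∀ x, ¬ r.SameCycle x (p x) := by
    rintro x ⟨k, hk⟩
    rcases Int.even_or_odd' k with ⟨j, rfl | rfl⟩
    · apply hp' ((r ^ j) x)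
      rw [hprk', Equiv.Perm.inv_eq_iff_eq, ← hk, two_mul, zpow_add, Equiv.Perm.mul_apply]
    · apply hn' ((r ^ j) x)
      apply p.injective
      rw [hprk']
      symm
      rw [Equiv.Perm.inv_eq_iff_eq, ← hk, ← Equiv.Perm.mul_apply p n, ← hr,
        ← Equiv.Perm.mul_apply, ← Equiv.Perm.mul_apply]
      congr 1
      rw [← zpow_add_one, ← zpow_add]
      congr 1
      ring
  let Q := Quotient (Equiv.Perm.SameCycle.setoid r)
  let t : Q → Q := Quotient.map p (by
    rintro x y ⟨k, rfl⟩
    exact ⟨-k, by rw [hprk', zpow_neg]⟩)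
  have ht : ∀ x : X, t (Quotient.mk _ x) = Quotient.mk _ (p x) := fun x => rfl
  have htt : ∀ q, t (t q) = q := fun q => Quotient.inductionOn q fun x => by rw [ht, ht, hp]
  have htne : ∀ q, q ≠ t q := fun q => Quotient.inductionOn q fun x h => hfree x (Quotient.exact h)
  -- `t` pairs the cycles of `r` without fixed points; a well-order selects one cycle of each pair,
  -- with no finiteness needed.
  let f : Q → Bool := fun q => decide (WellOrderingRel q (t q))
  have hf : ∀ q, f (t q) = !f q := by
    intro q
    simp only [f, htt]
    rcases trichotomous_of WellOrderingRel q (t q) with h | h | h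
    · simp [h, asymm_of WellOrderingRel h]
    · exact (htne q h).elim
    · simp [h, asymm_of WellOrderingRel h]
  have hgp : ∀ x, f (Quotient.mk _ (p x)) = !f (Quotient.mk _ x) := fun x => by rw [← ht, hf]
  refine ⟨fun x => f (Quotient.mk _ x), hgp, fun x => ?_⟩
  -- `r (n x) = p x`, so a colouring by cycles of `r` that is reversed by `p` is also reversed by
  -- `n`.
  have : (Quotient.mk _ (n x) : Q) = Quotient.mk _ (p x) := by
    apply Quotient.sound
    exact ⟨1, by simp [hr, hn]⟩
  change f (Quotient.mk _ (n x)) = _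
  rw [this, hgp]

/-- The union of two matchings, given as involutions, is bipartite. -/
theorem exists_coloring_of_involutions {E : Type*} (p n : E → E)
    (hp : ∀ x, p (p x) = x) (hn : ∀ x, n (n x) = x) :
    ∃ f : E → Bool, (∀ x, p x ≠ x → f (p x) ≠ f x) ∧ ∀ x, n x ≠ x → f (n x) ≠ f x := by
  classical
  -- Fixed points are removed by doubling: on two copies of `E`, a fixed point is exchanged with its
  -- own copy. The colouring is then read off on one copy.
  have key : ∀ q : E → E, (∀ x, q (q x) = x) → ∃ q' : Equiv.Perm (E × Bool),
      (∀ x, q' (q' x) = x) ∧ (∀ x, q' x ≠ x) ∧ ∀ x, q x ≠ x → q' (x, false) = (q x, false) := by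
    intro q hq
    have hinv : Function.Involutive
        (fun x : E × Bool => (q x.1, if q x.1 = x.1 then !x.2 else x.2)) := by
      rintro ⟨x, b⟩
      by_cases h : q x = x
      · simp [h]
      · simp [hq, h, Ne.symm h]
    refine ⟨hinv.toPerm, hinv, ?_, ?_⟩
    · rintro ⟨x, b⟩ h
      by_cases hx : q x = x <;> simp [hx] at h
    · intro x hx
      simp [hx]
  obtain ⟨p', hp1, hp2, hp3⟩ := key p hp
  obtain ⟨n', hn1, hn2, hn3⟩ := key n hn
  obtain ⟨g, hg1, hg2⟩ := exists_coloring_of_free_involutions p' n' hp1 hn1 hp2 hn2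
  refine ⟨fun x => g (x, false), fun x hx => ?_, fun x hx => ?_⟩
  · dsimp only
    rw [← hp3 x hx, hg1]
    simp
  · dsimp only
    rw [← hn3 x hx, hg2]
    simp

/-- A map with fibres of size at most two has an involution exchanging the elements of each
fibre. -/
theorem exists_involution_of_fiber_le_two {E W : Type*} (P : E → W)
    (hP : ∀ e₁ e₂ e₃, P e₁ = P e₂ → P e₁ = P e₃ → e₁ = e₂ ∨ e₁ = e₃ ∨ e₂ = e₃) :
    ∃ p : E → E, (∀ e, p (p e) = e) ∧ ∀ e e', e' ≠ e → P e' = P e → e' = p e := by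
  classical
  let p : E → E := fun e => if h : ∃ e', e' ≠ e ∧ P e' = P e then h.choose else e
  have h1 : ∀ e e', e' ≠ e → P e' = P e → e' = p e := by
    intro e e' hne he
    have h : ∃ e', e' ≠ e ∧ P e' = P e := ⟨e', hne, he⟩
    have hp : p e = h.choose := dif_pos h
    rw [hp]
    rcases hP e e' h.choose he.symm h.choose_spec.2.symm with h' | h' | h'
    exacts [(hne h'.symm).elim, (h.choose_spec.1 h'.symm).elim, h']
  refine ⟨p, fun e => ?_, h1⟩
  by_cases h : ∃ e', e' ≠ e ∧ P e' = P e
  · have hp : p e = h.choose := dif_pos h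
    rw [hp]
    exact (h1 _ _ h.choose_spec.1.symm h.choose_spec.2.symm).symm
  · have hp : p e = e := dif_neg h
    rw [hp, hp]

variable {V : Type*}

/-- A bipartite edge set of maximum degree at most two splits into two matchings. -/
theorem PairOn.of_bipartite [DecidableEq V] {G : SimpleGraph V} (S : Set V)
    (E : Finset (Sym2 V)) (hE : ∀ e ∈ E, e ∈ G.edgeSet) (hS : ∀ e ∈ E, ∀ v ∈ e, v ∈ S)
    (c : V → Bool) (hc : ∀ x y, s(x, y) ∈ E → c x ≠ c y)
    (hdeg : ∀ v, (E.filter (v ∈ ·)).card ≤ 2) :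
    ∃ p q, p + q = E.card ∧ PairOn G S p q := by
  have hend : ∀ b : Bool, ∀ e : E, ∃ v, v ∈ e.1 ∧ c v = b := by
    rintro b ⟨e, he⟩
    induction e with
    | _ x y =>
      have := hc x y he
      by_cases hx : c x = b
      · exact ⟨x, by simp, hx⟩
      · refine ⟨y, by simp, ?_⟩
        revert this hx
        generalize c x = u, c y = v
        cases b <;> cases u <;> cases v <;> simp
  choose P hP hPc using hend
  have huniq : ∀ b (e : E) v, v ∈ e.1 → c v = b → v = P b e := by
    rintro b ⟨e, he⟩ v hv hcv
    have h1 := hP b ⟨e, he⟩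
    have h2 := hPc b ⟨e, he⟩
    dsimp only at h1 hv
    by_contra hne
    have : e = s(v, P b ⟨e, he⟩) := (Sym2.mem_and_mem_iff hne).1 ⟨hv, h1⟩
    exact hc _ _ (this ▸ he) (hcv.trans h2.symm)
  have hfib : ∀ b (e₁ e₂ e₃ : E), P b e₁ = P b e₂ → P b e₁ = P b e₃ →
      e₁ = e₂ ∨ e₁ = e₃ ∨ e₂ = e₃ := by
    intro b e₁ e₂ e₃ h12 h13
    by_contra! hne
    have hsub : ({e₁.1, e₂.1, e₃.1} : Finset (Sym2 V)) ⊆ E.filter (P b e₁ ∈ ·) := by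
      intro e he
      simp only [Finset.mem_insert, Finset.mem_singleton] at he
      rw [Finset.mem_filter]
      rcases he with rfl | rfl | rfl
      · exact ⟨e₁.2, hP b e₁⟩
      · exact ⟨e₂.2, h12 ▸ hP b e₂⟩
      · exact ⟨e₃.2, h13 ▸ hP b e₃⟩
    have h3 : ({e₁.1, e₂.1, e₃.1} : Finset (Sym2 V)).card = 3 :=
      Finset.card_eq_three.2 ⟨_, _, _, fun h => hne.1 (Subtype.ext h),
        fun h => hne.2.1 (Subtype.ext h), fun h => hne.2.2 (Subtype.ext h), rfl⟩
    have := Finset.card_le_card hsub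
    have := hdeg (P b e₁)
    omega
  -- `P b e` is the end of `e` with colour `b`. By the degree bound, at most two edges share such an
  -- end; `p` and `n` exchange the edges meeting at a vertex of colour `true` and `false`
  -- respectively. A colouring reversed by both is a proper 2-colouring of the edges.
  obtain ⟨p, hp1, hp2⟩ := exists_involution_of_fiber_le_two (P true) (hfib true)
  obtain ⟨n, hn1, hn2⟩ := exists_involution_of_fiber_le_two (P false) (hfib false)
  obtain ⟨f, hf1, hf2⟩ := exists_coloring_of_involutions p n hp1 hn1
  have hproper : ∀ e e' : E, e' ≠ e → ∀ v, v ∈ e.1 → v ∈ e'.1 → f e' ≠ f e := by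
    intro e e' hne v hv hv'
    have h : P (c v) e' = P (c v) e :=
      (huniq _ e' v hv' rfl).symm.trans (huniq _ e v hv rfl)
    cases hcv : c v <;> rw [hcv] at h
    · have := hn2 e e' hne h
      subst this
      exact hf2 e hne
    · have := hp2 e e' hne h
      subst this
      exact hf1 e hne
  let H : Bool → Finset (Sym2 V) := fun b =>
    (E.attach.filter (f · = b)).map ⟨_, Subtype.val_injective⟩
  have hmem : ∀ b e, e ∈ H b ↔ ∃ h : e ∈ E, f ⟨e, h⟩ = b := by
    intro b e
    simp [H]
  have hH : ∀ b, IsMatchingOf G (H b) := by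
    intro b
    refine ⟨fun e he => ?_, fun e he e' he' hne v hv hv' => ?_⟩
    · obtain ⟨h, -⟩ := (hmem b e).1 he
      exact hE e h
    · obtain ⟨h, hb⟩ := (hmem b e).1 he
      obtain ⟨h', hb'⟩ := (hmem b e').1 he'
      exact hproper ⟨e, h⟩ ⟨e', h'⟩ (fun h => hne (congrArg Subtype.val h).symm) v hv hv'
        (hb'.trans hb.symm)
  refine ⟨_, _, ?_, H true, H false, ⟨hH _, hH _, ?_⟩, ?_, ?_, rfl, rfl⟩
  · simp only [H, Finset.card_map]
    have := Finset.card_filter_add_card_filter_not (s := E.attach) (fun e => f e = true)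
    simpa using this
  · rw [Finset.disjoint_left]
    intro e he he'
    obtain ⟨h, hb⟩ := (hmem _ e).1 he
    obtain ⟨h', hb'⟩ := (hmem _ e).1 he'
    simp [hb] at hb'
  · exact fun e he => hS e ((hmem _ e).1 he).1
  · exact fun e he => hS e ((hmem _ e).1 he).1

end DisjointMatchings

/-! ### Translation between path systems and spanning S-forests. -/

namespace DisjointMatchings

variable {V : Type*}

/-- `i` and `j` are consecutive on the path `0, 1, 2, 3, 4`. -/
abbrev Consecutive (i j : Fin 5) : Prop := (i : ℕ) + 1 = j ∨ (j : ℕ) + 1 = i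

/-- `F` is the graph formed by the paths of `P` and the edges joining their centres. -/
structure PathSystem.Spans {G : SimpleGraph V} {A : Type*} (P : PathSystem G A)
    (F : SimpleGraph V) : Prop where
  surj : ∀ v, ∃ a i, v = P.φ a i
  adj_iff : ∀ a b i j, F.Adj (P.φ a i) (P.φ b j) ↔
    (a = b ∧ Consecutive i j) ∨ (b = P.τ a ∧ i = 2 ∧ j = 2)

instance : DecidableRel spanner.Adj := fun x y =>
  decidable_of_iff ((s(x, y) = s(0, 1) ∨ s(x, y) = s(1, 2) ∨ s(x, y) = s(2, 3) ∨
    s(x, y) = s(3, 4) ∨ s(x, y) = s(5, 6) ∨ s(x, y) = s(6, 7) ∨ s(x, y) = s(7, 8) ∨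
    s(x, y) = s(8, 9) ∨ s(x, y) = s(2, 7)) ∧ x ≠ y) (by
      simp only [spanner, SimpleGraph.fromEdgeSet_adj, Set.mem_insert_iff, Set.mem_singleton_iff])

/-- The vertices of the spanner, as positions on two paths. -/
def spannerVertex (b : Bool) (i : Fin 5) : Fin 10 :=
  if b then Fin.natAdd 5 i else Fin.castAdd 5 i

theorem spanner_adj_iff : ∀ b b' i j, spanner.Adj (spannerVertex b i) (spannerVertex b' j) ↔
    (b = b' ∧ Consecutive i j) ∨ (b' = (!b) ∧ i = 2 ∧ j = 2) := by
  decide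

theorem spannerVertex_inj : ∀ b b' i j, spannerVertex b i = spannerVertex b' j →
    b = b' ∧ i = j := by
  decide

theorem spannerVertex_surj : ∀ x, ∃ b i, x = spannerVertex b i := by
  decide

theorem spanner_connected : spanner.Connected := by
  have h2 : ∀ x, spanner.Reachable 2 x := by
    have h : ∀ {x y}, spanner.Reachable 2 x → spanner.Adj x y → spanner.Reachable 2 y :=
      fun h h' => h.trans h'.reachable
    have r2 : spanner.Reachable 2 2 := SimpleGraph.Reachable.refl _
    have r1 : spanner.Reachable 2 1 := h r2 (by decide)
    have r3 : spanner.Reachable 2 3 := h r2 (by decide)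
    have r7 : spanner.Reachable 2 7 := h r2 (by decide)
    have r6 : spanner.Reachable 2 6 := h r7 (by decide)
    have r8 : spanner.Reachable 2 8 := h r7 (by decide)
    intro x
    fin_cases x
    exacts [h r1 (by decide), r1, r2, r3, h r3 (by decide), h r6 (by decide), r6, r7, r8,
      h r8 (by decide)]
  exact ⟨fun x y => (h2 x).symm.trans (h2 y)⟩

theorem spanner_isTree : spanner.IsTree := by
  rw [SimpleGraph.isTree_iff_connected_and_card]
  refine ⟨spanner_connected, ?_⟩
  rw [Nat.card_eq_fintype_card, Nat.card_eq_fintype_card]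
  decide

theorem isAcyclic_of_connectedComponent {F : SimpleGraph V}
    (h : ∀ c : F.ConnectedComponent, c.toSimpleGraph.IsAcyclic) : F.IsAcyclic := by
  classical
  intro v p hp
  have hc : (F.induce (F.connectedComponentMk v).supp).IsAcyclic := h _
  have hsupp : ∀ x ∈ p.support, x ∈ (F.connectedComponentMk v).supp := fun x hx =>
    (SimpleGraph.ConnectedComponent.sound ⟨p.takeUntil x hx⟩).symm
  refine hc (p.induce _ hsupp) ?_
  refine (SimpleGraph.Walk.isCycle_map_iff_of_injective
    (f := (SimpleGraph.Embedding.induce (F.connectedComponentMk v).supp).toHom)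
    Subtype.val_injective).1 ?_
  have key := SimpleGraph.Walk.map_induce p hsupp
  exact Eq.mpr (congrArg SimpleGraph.Walk.IsCycle key) hp

namespace PathSystem

variable {G : SimpleGraph V} {A : Type*}

/-- The forest consists of the paths and the centre edges. The component of path `a` is formed by
the paths `a` and `P.τ a`, laid out as a copy of `spanner`; acyclicity then follows from that of the
spanner, component by component. -/
theorem isSGraph (P : PathSystem G A) (hP : ∀ v, ∃ a i, v = P.φ a i) : IsSGraph G := by
  classical
  let R : A → A → Fin 5 → Fin 5 → Prop := fun a b i j =>
    (a = b ∧ Consecutive i j) ∨ (b = P.τ a ∧ i = 2 ∧ j = 2)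
  let F : SimpleGraph V :=
    { Adj := fun v w => ∃ a b i j, v = P.φ a i ∧ w = P.φ b j ∧ R a b i j
      symm := ⟨by
        rintro v w ⟨a, b, i, j, rfl, rfl, ⟨rfl, h⟩ | ⟨rfl, rfl, rfl⟩⟩
        · exact ⟨a, a, j, i, rfl, rfl, Or.inl ⟨rfl, h.symm⟩⟩
        · exact ⟨_, _, _, _, rfl, rfl, Or.inr ⟨(P.invol a).symm, rfl, rfl⟩⟩⟩
      loopless := ⟨by
        rintro v ⟨a, b, i, j, rfl, h, ⟨rfl, h'⟩ | ⟨rfl, rfl, rfl⟩⟩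
        · obtain ⟨-, rfl⟩ := P.inj _ _ _ _ h
          rcases h' with h' | h' <;> omega
        · exact P.ne a (P.inj _ _ _ _ h).1.symm⟩ }
  have hF : ∀ a b i j, F.Adj (P.φ a i) (P.φ b j) ↔ R a b i j := by
    intro a b i j
    constructor
    · rintro ⟨a', b', i', j', h, h', h''⟩
      obtain ⟨rfl, rfl⟩ := P.inj _ _ _ _ h
      obtain ⟨rfl, rfl⟩ := P.inj _ _ _ _ h'
      exact h''
    · exact fun h => ⟨a, b, i, j, rfl, rfl, h⟩
  have hle : F ≤ G := by
    rintro v w ⟨a, b, i, j, rfl, rfl, ⟨rfl, h⟩ | ⟨rfl, rfl, rfl⟩⟩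
    · have key : ∀ i j : Fin 5, (i : ℕ) + 1 = j → G.Adj (P.φ a i) (P.φ a j) := by
        intro i j h
        match i, j, h with
        | 0, 1, _ => exact P.adj01 a
        | 1, 2, _ => exact P.adj12 a
        | 2, 3, _ => exact P.adj23 a
        | 3, 4, _ => exact P.adj34 a
      rcases h with h | h
      exacts [key i j h, (key j i h).symm]
    · exact P.adjC a
  have hcomp : ∀ c : F.ConnectedComponent, Nonempty (c.toSimpleGraph ≃g spanner) := by
    intro c
    obtain ⟨v, rfl⟩ := c.exists_rep
    obtain ⟨a, i₀, rfl⟩ := hP v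
    let sel : Bool → A := fun b => if b then P.τ a else a
    have hsel : ∀ b b', sel b = sel b' ↔ b = b' := by
      intro b b'
      cases b <;> cases b' <;> simp [sel, P.ne a, (P.ne a).symm]
    have hselτ : ∀ b, P.τ (sel b) = sel (!b) := by
      intro b
      cases b <;> simp [sel, P.invol]
    choose bit pos hbp using spannerVertex_surj
    let ψ : Fin 10 → V := fun x => P.φ (sel (bit x)) (pos x)
    have hψ : ∀ b i, ψ (spannerVertex b i) = P.φ (sel b) i := by
      intro b i
      obtain ⟨h1, h2⟩ := spannerVertex_inj _ _ _ _ (hbp (spannerVertex b i))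
      simp only [ψ, ← h1, ← h2]
    have hinj : Function.Injective ψ := by
      intro x y h
      obtain ⟨h1, h2⟩ := P.inj _ _ _ _ h
      rw [hbp x, hbp y, (hsel _ _).1 h1, h2]
    have hadj : ∀ x y, F.Adj (ψ x) (ψ y) ↔ spanner.Adj x y := by
      intro x y
      rw [hbp x, hbp y, hψ, hψ, hF, spanner_adj_iff]
      simp only [R, hselτ, hsel]
    have hrange : Set.range ψ = (F.connectedComponentMk (P.φ a i₀)).supp := by
      have hv : P.φ a i₀ = ψ (spannerVertex false i₀) := by simp [hψ, sel]
      ext w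
      constructor
      · rintro ⟨x, rfl⟩
        let f : spanner →g F := ⟨ψ, fun {x y} h => (hadj x y).2 h⟩
        apply SimpleGraph.ConnectedComponent.sound
        rw [hv]
        exact (spanner_connected.preconnected x _).map f
      · intro hw
        have hr : F.Reachable (P.φ a i₀) w := (SimpleGraph.ConnectedComponent.exact hw).symm
        obtain ⟨p⟩ := hr
        have : ∀ {u w : V} (p : F.Walk u w), u ∈ Set.range ψ → w ∈ Set.range ψ := by
          intro u w p
          induction p with
          | nil => exact id
          | cons h p ih =>
            rintro ⟨x, rfl⟩
            apply ih
            obtain ⟨b, i, j, k, h1, rfl, h3⟩ := h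
            obtain ⟨rfl, rfl⟩ := P.inj _ _ _ _ h1
            rcases h3 with ⟨rfl, -⟩ | ⟨rfl, -, -⟩
            · exact ⟨spannerVertex (bit x) k, hψ _ _⟩
            · exact ⟨spannerVertex (!bit x) k, by rw [hψ, hselτ]⟩
        exact this p (hv ▸ ⟨_, rfl⟩)
    refine ⟨SimpleGraph.Iso.symm ⟨(Equiv.ofInjective ψ hinj).trans (Equiv.setCongr hrange), ?_⟩⟩
    intro x y
    exact hadj x y
  refine ⟨F, hle, isAcyclic_of_connectedComponent fun c => ?_, hcomp⟩
  exact (hcomp c).some.isAcyclic_iff.2 spanner_isTree.isAcyclic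

end PathSystem

/-- The paths that make up an S-forest. -/
theorem IsSpanningSForest.exists_pathSystem {G F : SimpleGraph V} (h : IsSpanningSForest G F) :
    ∃ P : PathSystem G (F.ConnectedComponent × Bool), P.Spans F := by
  have e : ∀ c : F.ConnectedComponent, c.toSimpleGraph ≃g spanner := fun c => (h.2.2 c).some
  let φ : F.ConnectedComponent × Bool → Fin 5 → V := fun a i =>
    ((e a.1).symm (spannerVertex a.2 i)).1
  have hφ : ∀ a i, F.connectedComponentMk (φ a i) = a.1 := fun a i =>
    ((e a.1).symm (spannerVertex a.2 i)).2
  have hinj : ∀ a b i j, φ a i = φ b j → a = b ∧ i = j := by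
    rintro ⟨c, b⟩ ⟨c', b'⟩ i j hij
    have hc : c = c' := (hφ (c, b) i).symm.trans ((congrArg _ hij).trans (hφ (c', b') j))
    subst hc
    have := (e c).symm.injective (Subtype.ext hij)
    obtain ⟨rfl, rfl⟩ := spannerVertex_inj _ _ _ _ this
    exact ⟨rfl, rfl⟩
  have hadj : ∀ a b i j, F.Adj (φ a i) (φ b j) ↔
      (a = b ∧ Consecutive i j) ∨ (b = (a.1, !a.2) ∧ i = 2 ∧ j = 2) := by
    rintro ⟨c, b⟩ ⟨c', b'⟩ i j
    by_cases hc : c = c'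
    · subst hc
      have h1 : F.Adj (φ (c, b) i) (φ (c, b') j) ↔
          spanner.Adj (spannerVertex b i) (spannerVertex b' j) :=
        (e c).symm.map_adj_iff
      rw [h1, spanner_adj_iff]
      simp
    · have : ¬ F.Adj (φ (c, b) i) (φ (c', b') j) := by
        intro h'
        apply hc
        have := SimpleGraph.ConnectedComponent.sound h'.reachable
        rwa [hφ, hφ] at this
      simp [this, hc, Ne.symm hc]
  refine ⟨⟨φ, fun a => (a.1, !a.2), hinj, fun a => by simp, fun a h' => ?_,
    fun a => h.1 ((hadj _ _ _ _).2 (Or.inl ⟨rfl, by decide⟩)),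
    fun a => h.1 ((hadj _ _ _ _).2 (Or.inl ⟨rfl, by decide⟩)),
    fun a => h.1 ((hadj _ _ _ _).2 (Or.inl ⟨rfl, by decide⟩)),
    fun a => h.1 ((hadj _ _ _ _).2 (Or.inl ⟨rfl, by decide⟩)),
    fun a => h.1 ((hadj _ _ _ _).2 (by simp))⟩, ?_, hadj⟩
  · have := congrArg Prod.snd h'
    simp at this
  · intro v
    obtain ⟨b, i, hbi⟩ := spannerVertex_surj (e (F.connectedComponentMk v) ⟨v, rfl⟩)
    refine ⟨(F.connectedComponentMk v, b), i, ?_⟩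
    change v = ((e (F.connectedComponentMk v)).symm (spannerVertex b i)).1
    rw [← hbi]
    exact (congrArg Subtype.val
      ((e (F.connectedComponentMk v)).symm_apply_apply ⟨v, rfl⟩)).symm

end DisjointMatchings

/-! ### Degrees, bases and edge classes in path coordinates; conditions (a) and (b). -/

namespace DisjointMatchings
namespace PathSystem

variable {V : Type*} {G F : SimpleGraph V} {A : Type*} {P : PathSystem G A}

theorem Spans.flip [DecidableEq A] (hS : P.Spans F) (a : A) : (P.flip a).Spans F := by
  have hφ : ∀ b i, (P.flip a).φ b i = P.φ b (if b = a then i.rev else i) := by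
    intro b i
    unfold PathSystem.flip
    dsimp only
    split_ifs <;> rfl
  refine ⟨fun v => ?_, fun b c i j => ?_⟩
  · obtain ⟨b, i, rfl⟩ := hS.surj v
    refine ⟨b, if b = a then i.rev else i, ?_⟩
    rw [hφ]
    split_ifs <;> simp
  · rw [hφ, hφ, hS.adj_iff]
    have h2 : ∀ i : Fin 5, i.rev = 2 ↔ i = 2 := by decide
    have hC : ∀ i j : Fin 5, Consecutive i.rev j.rev ↔ Consecutive i j := by decide
    change _ ↔ _ ∨ (c = P.τ b ∧ _)
    have hb : ∀ (b : A) (i : Fin 5), (if b = a then i.rev else i) = 2 ↔ i = 2 := by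
      intro b i
      split_ifs <;> simp [h2]
    rw [hb, hb]
    apply or_congr_left
    apply and_congr_right
    rintro rfl
    split_ifs <;> simp [hC]

theorem Spans.neighborSet_eq (hS : P.Spans F) (a : A) (i : Fin 5) :
    F.neighborSet (P.φ a i) =
      ![{P.φ a 1}, {P.φ a 0, P.φ a 2}, {P.φ a 1, P.φ a 3, P.φ (P.τ a) 2}, {P.φ a 2, P.φ a 4},
        {P.φ a 3}] i := by
  ext w
  obtain ⟨b, j, rfl⟩ := hS.surj w
  rw [SimpleGraph.mem_neighborSet, hS.adj_iff]
  fin_cases i <;> fin_cases j <;> simp [φ_eq_iff, Consecutive, eq_comm]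

theorem Spans.isIVertex_iff (hS : P.Spans F) (a : A) (i : Fin 5) (k : ℕ) :
    IsIVertex F k (P.φ a i) ↔ ![1, 2, 3, 2, 1] i = k := by
  have h3 : ({P.φ a 1, P.φ a 3, P.φ (P.τ a) 2} : Set V).ncard = 3 :=
    Set.ncard_eq_three.2 ⟨_, _, _, by simp [φ_eq_iff], by simp [φ_eq_iff], by simp [φ_eq_iff], rfl⟩
  rw [IsIVertex, hS.neighborSet_eq]
  fin_cases i
  · simp
  · simp [φ_eq_iff]
  · simp [h3]
  · simp [φ_eq_iff]
  · simp

theorem Spans.isIVertex_one_iff (hS : P.Spans F) (a : A) (i : Fin 5) :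
    IsIVertex F 1 (P.φ a i) ↔ i = 0 ∨ i = 4 := by
  rw [hS.isIVertex_iff]; revert i; decide

theorem Spans.isIVertex_two_iff (hS : P.Spans F) (a : A) (i : Fin 5) :
    IsIVertex F 2 (P.φ a i) ↔ i = 1 ∨ i = 3 := by
  rw [hS.isIVertex_iff]; revert i; decide

theorem Spans.isIVertex_three_iff (hS : P.Spans F) (a : A) (i : Fin 5) :
    IsIVertex F 3 (P.φ a i) ↔ i = 2 := by
  rw [hS.isIVertex_iff]; revert i; decide

theorem Spans.adj (hS : P.Spans F) (a : A) {i j : Fin 5} (h : Consecutive i j) :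
    F.Adj (P.φ a i) (P.φ a j) :=
  (hS.adj_iff _ _ _ _).2 (Or.inl ⟨rfl, h⟩)

theorem Spans.isBase (hS : P.Spans F) (a : A) : IsBase F (P.φ a 0) (P.φ a 2) := by
  have h01 := hS.adj a (i := 0) (j := 1) (by decide)
  have h12 := hS.adj a (i := 1) (j := 2) (by decide)
  refine ⟨(hS.isIVertex_three_iff _ _).2 rfl, h01.reachable.trans h12.reachable, ?_⟩
  intro w hw hr
  have h2 : F.dist (P.φ a 0) (P.φ a 2) ≤ 2 :=
    SimpleGraph.dist_le (SimpleGraph.Walk.cons h01 (SimpleGraph.Walk.cons h12 .nil))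
  obtain ⟨b, j, rfl⟩ := hS.surj w
  rw [hS.isIVertex_three_iff] at hw
  subst hw
  have hne : F.dist (P.φ a 0) (P.φ b 2) ≠ 0 := by
    rw [Ne, hr.dist_eq_zero_iff, φ_eq_iff]
    simp
  have hne1 : F.dist (P.φ a 0) (P.φ b 2) ≠ 1 := by
    rw [Ne, SimpleGraph.dist_eq_one_iff_adj, hS.adj_iff]
    simp [Consecutive]
  omega

theorem Spans.mem_edgesU_iff (hS : P.Spans F) (e : Sym2 V) :
    e ∈ edgesU F ↔ ∃ a, e = s(P.φ a 0, P.φ a 1) ∨ e = s(P.φ a 3, P.φ a 4) := by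
  constructor
  · rintro ⟨he, v, hv, h1⟩
    obtain ⟨w, rfl⟩ := hv
    obtain ⟨a, i, rfl⟩ := hS.surj v
    have hw : w ∈ F.neighborSet (P.φ a i) := he
    rw [hS.neighborSet_eq] at hw
    refine ⟨a, ?_⟩
    rcases (hS.isIVertex_one_iff _ _).1 h1 with rfl | rfl
    · obtain rfl : w = _ := hw
      exact Or.inl rfl
    · obtain rfl : w = _ := hw
      exact Or.inr Sym2.eq_swap
  · rintro ⟨a, rfl | rfl⟩
    · exact ⟨hS.adj a (by decide), _, Sym2.mem_mk_left _ _, (hS.isIVertex_one_iff _ _).2 (by simp)⟩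
    · exact ⟨hS.adj a (by decide), _, Sym2.mem_mk_right _ _, (hS.isIVertex_one_iff _ _).2 (by simp)⟩

theorem Spans.mem_edgesL_iff (hS : P.Spans F) (e : Sym2 V) :
    e ∈ edgesL F ↔ ∃ a, e = s(P.φ a 1, P.φ a 2) ∨ e = s(P.φ a 2, P.φ a 3) := by
  constructor
  · rintro ⟨he, hU, v, hv, h1⟩
    obtain ⟨w, rfl⟩ := hv
    obtain ⟨a, i, rfl⟩ := hS.surj v
    have hw : w ∈ F.neighborSet (P.φ a i) := he
    rw [hS.neighborSet_eq] at hw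
    rw [hS.mem_edgesU_iff] at hU
    refine ⟨a, ?_⟩
    rcases (hS.isIVertex_two_iff _ _).1 h1 with rfl | rfl
    · rcases hw with rfl | hw
      · exact (hU ⟨a, Or.inl Sym2.eq_swap⟩).elim
      · obtain rfl : w = _ := hw
        exact Or.inl rfl
    · rcases hw with rfl | hw
      · exact Or.inr Sym2.eq_swap
      · obtain rfl : w = _ := hw
        exact (hU ⟨a, Or.inr rfl⟩).elim
  · rintro ⟨a, rfl | rfl⟩
    · refine ⟨hS.adj a (by decide), ?_, _, Sym2.mem_mk_left _ _,
        (hS.isIVertex_two_iff _ _).2 (by simp)⟩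
      rw [hS.mem_edgesU_iff]
      simp [φ_eq_iff]
    · refine ⟨hS.adj a (by decide), ?_, _, Sym2.mem_mk_right _ _,
        (hS.isIVertex_two_iff _ _).2 (by simp)⟩
      rw [hS.mem_edgesU_iff]
      simp [φ_eq_iff]

/-- A `1`-vertex is the first vertex of a path, up to reversing that path. -/
theorem Spans.exists_of_isIVertex_one (hS : P.Spans F) {u : V} (hu : IsIVertex F 1 u) :
    ∃ Q : PathSystem G A, Q.Spans F ∧ ∃ a, u = Q.φ a 0 := by
  classical
  obtain ⟨a, i, rfl⟩ := hS.surj u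
  rcases (hS.isIVertex_one_iff _ _).1 hu with rfl | rfl
  · exact ⟨P, hS, a, rfl⟩
  · exact ⟨P.flip a, hS.flip a, a, by rw [flip_φ_self]; rfl⟩

variable [Fintype A]

/-- A leaf is adjacent in `G` to at most positions 1 and 2 of its own path; these edges belong to U
and Δ respectively, since position 2 is the base of the leaf. -/
theorem Spans.not_adj_edgesB (hS : P.Spans F) (hB : Balanced G (Fintype.card A))
    (hG : ∀ v, ∃ w, G.Adj v w) (a : A) (w : V) : s(P.φ a 0, w) ∉ edgesB G F := by
  rintro ⟨he, hn⟩
  apply hn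
  rcases P.eq_of_adj_leaf hB hG a he with rfl | rfl
  · exact Or.inl (Or.inr ((hS.mem_edgesU_iff _).2 ⟨a, Or.inl rfl⟩))
  · exact Or.inr ⟨he, _, _, rfl, (hS.isIVertex_one_iff _ _).2 (by simp), hS.isBase a⟩

theorem Spans.conditionA (hS : P.Spans F) (hB : Balanced G (Fintype.card A))
    (hG : ∀ v, ∃ w, G.Adj v w) : ConditionA G F := by
  rintro u hu e he ⟨w, rfl⟩
  obtain ⟨Q, hQ, a, rfl⟩ := hS.exists_of_isIVertex_one hu
  exact hQ.not_adj_edgesB hB hG a w he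

/-- The Δ-edge closes a triangle on positions 0, 1, 2 of a path. The only 2-vertex adjacent to the
leaf is position 1, and by `eq_of_adj_of_triangle` its edges lie in U or L. -/
theorem Spans.conditionB (hS : P.Spans F) (hB : Balanced G (Fintype.card A))
    (hG : ∀ v, ∃ w, G.Adj v w) : ConditionB G F := by
  rintro u hu ⟨d, ⟨hd, u', w, rfl, hu', hw⟩, hud⟩ v hv huv e he ⟨x, rfl⟩
  obtain ⟨Q, hQ, a, rfl⟩ := hS.exists_of_isIVertex_one hu
  have h3 : IsIVertex F 3 w := hw.1
  have htri : G.Adj (Q.φ a 0) (Q.φ a 2) := by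
    rcases Sym2.mem_iff.1 hud with rfl | rfl
    · rcases Q.eq_of_adj_leaf hB hG a hd with rfl | rfl
      · rw [hQ.isIVertex_three_iff] at h3
        simp at h3
      · exact hd
    · rw [hQ.isIVertex_three_iff] at h3
      simp at h3
  have hv1 : v = Q.φ a 1 := by
    rcases Q.eq_of_adj_leaf hB hG a huv with rfl | rfl
    · rfl
    · rw [hQ.isIVertex_two_iff] at hv
      simp at hv
  subst hv1
  apply he.2
  rcases Q.eq_of_adj_of_triangle hB hG a htri he.1 with rfl | rfl
  · exact Or.inl (Or.inr ((hQ.mem_edgesU_iff _).2 ⟨a, Or.inl Sym2.eq_swap⟩))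
  · exact Or.inl (Or.inl ((hQ.mem_edgesL_iff _).2 ⟨a, Or.inl rfl⟩))

end PathSystem
end DisjointMatchings

/-! ### Degree balance along alternating cycles. -/

namespace DisjointMatchings

/-- In a closed alternating trail of even length every vertex lies on equally many edges of either
kind. -/
theorem AlternatesFrom.balance {V : Type*} [DecidableEq V] {G : SimpleGraph V}
    {A B : Set (Sym2 V)} [DecidablePred (· ∈ A)] [DecidablePred (· ∈ B)] :
    ∀ {u v : V} (p : G.Walk u v), AlternatesFrom A B p → Even p.length →
      p.edges.countP (· ∈ A) = p.edges.countP (· ∈ B) ∧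
      ∀ x, p.edges.countP (fun e => e ∈ A ∧ x ∈ e) + (if x = v then 1 else 0) =
        p.edges.countP (fun e => e ∈ B ∧ x ∈ e) + (if x = u then 1 else 0)
  | _, _, .nil, _, _ => by simp
  | _, _, .cons h .nil, _, hl => by simp at hl
  -- Edges are peeled off two at a time. For an open trail the starting vertex has one surplus
  -- `A`-edge and the final vertex one surplus `B`-edge; the correction terms record this and cancel
  -- when the trail is closed.
  | u, v, .cons (v := w) h (.cons (v := y) h' q), ha, hl => by
    have h0 := (ha 0 (by simp)).1 (by simp)
    have h1 := (ha 1 (by simp)).2 (by simp)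
    simp only [SimpleGraph.Walk.edges_cons, List.getElem_cons_zero, List.getElem_cons_succ]
      at h0 h1
    have hq : AlternatesFrom A B q := by
      intro i hi
      have := ha (i + 2) (by simpa using hi)
      simpa [Nat.even_add] using this
    obtain ⟨ih1, ih2⟩ := AlternatesFrom.balance q hq (by simpa [Nat.even_add] using hl)
    refine ⟨?_, fun x => ?_⟩
    · simp [h0.1, h0.2, h1.1, h1.2, ih1]
    · have hmem : ∀ {a b : V}, a ≠ b → (if x ∈ s(a, b) then 1 else 0) =
          (if x = a then 1 else 0) + (if x = b then 1 else 0) := by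
        intro a b hab
        by_cases hxa : x = a
        · subst hxa
          simp [hab]
        · simp [hxa]
      have hA : (SimpleGraph.Walk.cons h (.cons h' q)).edges.countP (fun e => e ∈ A ∧ x ∈ e) =
          q.edges.countP (fun e => e ∈ A ∧ x ∈ e) + (if x ∈ s(u, w) then 1 else 0) := by
        simp only [SimpleGraph.Walk.edges_cons, List.countP_cons, h0.1, h1.2]
        simp
      have hB : (SimpleGraph.Walk.cons h (.cons h' q)).edges.countP (fun e => e ∈ B ∧ x ∈ e) =
          q.edges.countP (fun e => e ∈ B ∧ x ∈ e) + (if x ∈ s(w, y) then 1 else 0) := by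
        simp only [SimpleGraph.Walk.edges_cons, List.countP_cons, h0.2, h1.1]
        simp
      have := ih2 x
      rw [hmem h.ne] at hA
      rw [hmem h'.ne] at hB
      omega

theorem IsAlternatingEvenCycle.balance {V : Type*} [DecidableEq V] {G : SimpleGraph V}
    {A B : Set (Sym2 V)} [DecidablePred (· ∈ A)] [DecidablePred (· ∈ B)] {v : V}
    {C : G.Walk v v} (hC : IsAlternatingEvenCycle A B C) :
    (C.edges.toFinset.filter (· ∈ A)).card = (C.edges.toFinset.filter (· ∈ B)).card ∧
    ∀ x, ((C.edges.toFinset.filter (· ∈ A)).filter (x ∈ ·)).card =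
      ((C.edges.toFinset.filter (· ∈ B)).filter (x ∈ ·)).card := by
  obtain ⟨ht, he, ha⟩ := hC
  have key : ∀ p : Sym2 V → Prop, ∀ [DecidablePred p],
      (C.edges.toFinset.filter p).card = C.edges.countP p := by
    intro p _
    rw [List.countP_eq_length_filter, ← List.toFinset_card_of_nodup (ht.edges_nodup.filter _),
      List.toFinset_filter]
    simp
  simp only [Finset.filter_filter, key]
  rcases ha with ha | ha
  · have := ha.balance C he
    exact ⟨this.1, fun x => by simpa using this.2 x⟩
  · have := ha.balance C he
    exact ⟨this.1.symm, fun x => by simpa using (this.2 x).symm⟩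

end DisjointMatchings

/-! ### Condition (c). -/

namespace DisjointMatchings
namespace PathSystem

variable {V : Type*} {G F : SimpleGraph V} {A : Type*} (P : PathSystem G A)

/-- The `k`-th edge of the path with index `a`. -/
def edge (x : A × Fin 4) : Sym2 V := s(P.φ x.1 x.2.castSucc, P.φ x.1 x.2.succ)

theorem edge_injective : Function.Injective P.edge := by
  rintro ⟨a, k⟩ ⟨b, l⟩ h
  simp only [edge, Sym2.eq_iff, φ_eq_iff] at h
  rcases h with ⟨⟨rfl, h⟩, -⟩ | ⟨⟨rfl, h⟩, -, h'⟩
  · rw [Fin.castSucc_inj] at h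
    rw [h]
  · rw [Fin.ext_iff] at h h'
    simp at h h'
    omega

variable {P}

theorem Spans.mem_edgesU_or_mem_edgesL_iff (hS : P.Spans F) (e : Sym2 V) :
    (e ∈ edgesU F ∨ e ∈ edgesL F) ↔ ∃ x, P.edge x = e := by
  rw [hS.mem_edgesU_iff, hS.mem_edgesL_iff]
  constructor
  · rintro (⟨a, rfl | rfl⟩ | ⟨a, rfl | rfl⟩)
    exacts [⟨(a, 0), rfl⟩, ⟨(a, 3), rfl⟩, ⟨(a, 1), rfl⟩, ⟨(a, 2), rfl⟩]
  · rintro ⟨⟨a, k⟩, rfl⟩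
    match k with
    | 0 => exact Or.inl ⟨a, Or.inl rfl⟩
    | 1 => exact Or.inr ⟨a, Or.inl rfl⟩
    | 2 => exact Or.inr ⟨a, Or.inr rfl⟩
    | 3 => exact Or.inl ⟨a, Or.inr rfl⟩

theorem edge_mem_edgesL_iff (hS : P.Spans F) (a : A) (k : Fin 4) :
    P.edge (a, k) ∈ edgesL F ↔ k = 1 ∨ k = 2 := by
  rw [hS.mem_edgesL_iff]
  have h1 : ∀ b, s(P.φ b 1, P.φ b 2) = P.edge (b, 1) := fun b => rfl
  have h2 : ∀ b, s(P.φ b 2, P.φ b 3) = P.edge (b, 2) := fun b => rfl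
  simp only [h1, h2, P.edge_injective.eq_iff, Prod.mk.injEq]
  constructor
  · rintro ⟨b, h | h⟩
    exacts [Or.inl h.2, Or.inr h.2]
  · rintro (h | h)
    exacts [⟨a, Or.inl ⟨rfl, h⟩⟩, ⟨a, Or.inr ⟨rfl, h⟩⟩]

theorem mem_edge_iff (P : PathSystem G A) (a b : A) (i : Fin 5) (k : Fin 4) :
    P.φ a i ∈ P.edge (b, k) ↔ a = b ∧ (i = k.castSucc ∨ i = k.succ) := by
  simp only [edge, Sym2.mem_iff, φ_eq_iff]
  tauto

variable [Fintype A] [DecidableEq V]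

/-- The edges of the paths. -/
def edges (P : PathSystem G A) : Finset (Sym2 V) := Finset.univ.image P.edge

theorem card_edges (P : PathSystem G A) : P.edges.card = 4 * Fintype.card A := by
  rw [edges, Finset.card_image_of_injective _ P.edge_injective]
  simp [mul_comm]

theorem card_edges_filter_mem_le (P : PathSystem G A) (a : A) (i : Fin 5) :
    (P.edges.filter (P.φ a i ∈ ·)).card ≤ ![1, 2, 2, 2, 1] i := by
  have h : P.edges.filter (P.φ a i ∈ ·) ⊆
      (Finset.univ.filter fun k : Fin 4 => i = k.castSucc ∨ i = k.succ).image
        fun k => P.edge (a, k) := by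
    intro e he
    rw [Finset.mem_filter, edges, Finset.mem_image] at he
    obtain ⟨⟨⟨b, k⟩, -, rfl⟩, he⟩ := he
    obtain ⟨rfl, h⟩ := (P.mem_edge_iff _ _ _ _).1 he
    exact Finset.mem_image_of_mem _ (by simpa using h)
  refine (Finset.card_le_card h).trans (Finset.card_image_le.trans ?_)
  clear h
  revert i
  decide

/-- Suppose C_B is bipartite. Exchanging the L-edges of `C` for its B-edges turns the path edges
into a set `W` with the same size and the same degrees, which is still bipartite. A 2-2 edge `xy` of
`C`, with the leaf edges at `x` and `y`, forms a component of `W` with three edges. The remaining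
edges split into matchings of sizes `p` and `q` with `p + q ≥ 4n - 3`, where n is the number of
paths. The larger matching of the component can be joined to either side, so balance gives `p + 2 ≤
2n` and `q + 2 ≤ 2n`, which is impossible. -/
theorem Spans.conditionC (hS : P.Spans F) (hB : Balanced G (Fintype.card A)) :
    ConditionC G F := by
  classical
  rintro v C hC ⟨x, y, hxy, hx, hy⟩ ⟨col⟩
  obtain ⟨htot, hbal⟩ := hC.balance
  set CL := C.edges.toFinset.filter (· ∈ edgesL F) with hCL
  set CB := C.edges.toFinset.filter (· ∈ edgesB G F) with hCB
  let W := (P.edges \ CL) ∪ CB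
  have hmemE : ∀ e, e ∈ P.edges ↔ e ∈ edgesU F ∨ e ∈ edgesL F := by
    intro e
    rw [hS.mem_edgesU_or_mem_edgesL_iff, edges]
    simp
  have hCLE : CL ⊆ P.edges := by
    intro e he
    rw [hmemE]
    exact Or.inr (Finset.mem_filter.1 he).2
  have hCBE : Disjoint P.edges CB := by
    rw [Finset.disjoint_left]
    intro e he he'
    apply (Finset.mem_filter.1 he').2.2
    rcases (hmemE e).1 he with h | h
    exacts [Or.inl (Or.inr h), Or.inl (Or.inl h)]
  have hWcard : W.card = 4 * Fintype.card A := by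
    rw [Finset.card_union_of_disjoint (hCBE.mono_left Finset.sdiff_subset),
      Finset.card_sdiff_of_subset hCLE, ← htot, ← P.card_edges]
    exact Nat.sub_add_cancel (Finset.card_le_card hCLE)
  have hWdeg : ∀ x, (W.filter (x ∈ ·)).card = (P.edges.filter (x ∈ ·)).card := by
    intro x
    have h1 : W.filter (x ∈ ·) =
        (P.edges.filter (x ∈ ·) \ CL.filter (x ∈ ·)) ∪ CB.filter (x ∈ ·) := by
      ext e
      simp only [W, Finset.mem_filter, Finset.mem_union, Finset.mem_sdiff]
      tauto
    have hsub : CL.filter (x ∈ ·) ⊆ P.edges.filter (x ∈ ·) := Finset.filter_subset_filter _ hCLE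
    rw [h1, Finset.card_union_of_disjoint, Finset.card_sdiff_of_subset hsub, ← hbal]
    · exact Nat.sub_add_cancel (Finset.card_le_card hsub)
    · exact (hCBE.mono (Finset.filter_subset _ _) (Finset.filter_subset _ _)).mono_left
        Finset.sdiff_subset
  have hWG : ∀ e ∈ W, e ∈ G.edgeSet := by
    intro e he
    rcases Finset.mem_union.1 he with he | he
    · obtain ⟨⟨a, k⟩, -, rfl⟩ := Finset.mem_image.1 (Finset.mem_sdiff.1 he).1
      match k with
      | 0 => exact P.adj01 a
      | 1 => exact P.adj12 a
      | 2 => exact P.adj23 a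
      | 3 => exact P.adj34 a
    · exact (Finset.mem_filter.1 he).2.1
  -- a two-colouring of the vertices
  let onC : A → Fin 4 → Prop := fun a k => P.edge (a, k) ∈ C.edges
  let c : V → Bool := fun v => decide (col v = 0)
  -- Centres keep the colour of C_B. A 2-vertex keeps it if its L-edge lies on `C`, in which case
  -- that edge is absent from `W`; otherwise it takes the colour opposite to its centre. Leaves take
  -- the colour opposite to their 2-vertex.
  let d : A → Fin 5 → Bool := fun a =>
    ![!(if onC a 1 then c (P.φ a 1) else !c (P.φ a 2)),
      if onC a 1 then c (P.φ a 1) else !c (P.φ a 2), c (P.φ a 2),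
      if onC a 2 then c (P.φ a 3) else !c (P.φ a 2),
      !(if onC a 2 then c (P.φ a 3) else !c (P.φ a 2))]
  choose idx pos hip using hS.surj
  let c' : V → Bool := fun v => d (idx v) (pos v)
  have hc' : ∀ a i, c' (P.φ a i) = d a i := by
    intro a i
    obtain ⟨h1, h2⟩ := P.inj _ _ _ _ (hip (P.φ a i))
    simp only [c', ← h1, ← h2]
  -- By the degree balance, a vertex on a B-edge of `C` also lies on an L-edge of `C`; so it is a
  -- centre, or a 2-vertex whose L-edge is on `C`.
  have hCBc : ∀ e ∈ CB, ∀ v ∈ e, c' v = c v := by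
    intro e he v hv
    have h1 : 0 < (CB.filter (v ∈ ·)).card :=
      Finset.card_pos.2 ⟨e, Finset.mem_filter.2 ⟨he, hv⟩⟩
    rw [← hbal] at h1
    obtain ⟨f, hf⟩ := Finset.card_pos.1 h1
    obtain ⟨hf, hvf⟩ := Finset.mem_filter.1 hf
    obtain ⟨hfC, hfL⟩ := Finset.mem_filter.1 hf
    rw [List.mem_toFinset] at hfC
    obtain ⟨⟨a, k⟩, rfl⟩ := (hS.mem_edgesU_or_mem_edgesL_iff f).1 (Or.inr hfL)
    rw [edge_mem_edgesL_iff hS] at hfL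
    obtain ⟨b, i, rfl⟩ := hS.surj v
    obtain ⟨rfl, hi⟩ := (P.mem_edge_iff _ _ _ _).1 hvf
    rw [hc']
    rcases hfL with rfl | rfl <;> rcases hi with rfl | rfl
    · simp [d, onC, hfC]
    · rfl
    · rfl
    · simp [d, onC, hfC]
  have hWc : ∀ x y, s(x, y) ∈ W → c' x ≠ c' y := by
    intro x y he
    rcases Finset.mem_union.1 he with he | he
    · obtain ⟨he, hn⟩ := Finset.mem_sdiff.1 he
      obtain ⟨⟨a, k⟩, -, h⟩ := Finset.mem_image.1 he
      have hk : c' (P.φ a k.castSucc) ≠ c' (P.φ a k.succ) := by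
        have hn' : k = 1 ∨ k = 2 → ¬ onC a k := by
          intro hk hon
          apply hn
          rw [← h]
          exact Finset.mem_filter.2 ⟨List.mem_toFinset.2 hon, (edge_mem_edgesL_iff hS _ _).2 hk⟩
        rw [hc', hc']
        match k with
        | 0 => simp [d]
        | 1 => simp [d, hn']
        | 2 => simp [d, hn']
        | 3 => simp [d]
      rcases Sym2.eq_iff.1 h with ⟨rfl, rfl⟩ | ⟨rfl, rfl⟩
      exacts [hk, hk.symm]
    · rw [hCBc _ he x (by simp), hCBc _ he y (by simp)]
      obtain ⟨he1, he2⟩ := Finset.mem_filter.1 he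
      have hadj : (edgePart (edgesB G F) C).Adj x y :=
        (SimpleGraph.fromEdgeSet_adj _).2 ⟨⟨List.mem_toFinset.1 he1, he2⟩, G.ne_of_adj he2.1⟩
      have := col.valid hadj
      simp only [c, ne_eq, decide_eq_decide]
      omega
  -- the component of `W` containing the edge `xy`
  have hlegs : ∀ z, IsIVertex F 2 z → ∃ l, s(l, z) ∈ W ∧ (P.edges.filter (l ∈ ·)).card ≤ 1 ∧
      (P.edges.filter (z ∈ ·)).card ≤ 2 ∧ s(l, z) ∈ edgesU F ∧ IsIVertex F 1 l ∧
      ∀ z', s(l, z') ∈ edgesU F → z' = z := by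
    intro z hz
    have hU : ∀ e ∈ edgesU F, e ∈ W := fun e he => Finset.mem_union_left _ <|
      Finset.mem_sdiff.2 ⟨(hmemE e).2 (Or.inl he), fun h => (Finset.mem_filter.1 h).2.2.1 he⟩
    obtain ⟨a, i, rfl⟩ := hS.surj z
    rcases (hS.isIVertex_two_iff _ _).1 hz with rfl | rfl
    · have h : s(P.φ a 0, P.φ a 1) ∈ edgesU F := (hS.mem_edgesU_iff _).2 ⟨a, Or.inl rfl⟩
      refine ⟨P.φ a 0, hU _ h, P.card_edges_filter_mem_le a 0, P.card_edges_filter_mem_le a 1, h,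
        (hS.isIVertex_one_iff _ _).2 (by simp), ?_⟩
      intro z' hz'
      have : z' ∈ F.neighborSet (P.φ a 0) := hz'.1
      rwa [hS.neighborSet_eq] at this
    · have h : s(P.φ a 4, P.φ a 3) ∈ edgesU F :=
        (hS.mem_edgesU_iff _).2 ⟨a, Or.inr Sym2.eq_swap⟩
      refine ⟨P.φ a 4, hU _ h, P.card_edges_filter_mem_le a 4, P.card_edges_filter_mem_le a 3, h,
        (hS.isIVertex_one_iff _ _).2 (by simp), ?_⟩
      intro z' hz'
      have : z' ∈ F.neighborSet (P.φ a 4) := hz'.1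
      rwa [hS.neighborSet_eq] at this
  have hne12 : ∀ u w, IsIVertex F 1 u → IsIVertex F 2 w → u ≠ w := by
    rintro u w h1 h2 rfl
    rw [IsIVertex] at h1 h2
    omega
  have hxyG : G.Adj x y := C.adj_of_mem_edges hxy
  have hxyne := hxyG.ne
  have hxyB : s(x, y) ∈ CB := by
    refine Finset.mem_filter.2 ⟨List.mem_toFinset.2 hxy, hxyG, ?_⟩
    have hF : s(x, y) ∉ F.edgeSet := by
      intro h
      obtain ⟨a, i, rfl⟩ := hS.surj x
      obtain ⟨b, j, rfl⟩ := hS.surj y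
      rw [SimpleGraph.mem_edgeSet, hS.adj_iff] at h
      rw [hS.isIVertex_two_iff] at hx hy
      rcases hx with rfl | rfl <;> rcases hy with rfl | rfl <;> simp [Consecutive] at h
    rintro ((h | h) | ⟨-, u, w, h, hu, -⟩)
    · exact hF h.1
    · exact hF h.1
    · have : u ∈ s(x, y) := h ▸ Sym2.mem_mk_left _ _
      rcases Sym2.mem_iff.1 this with h | h
      exacts [hne12 _ _ hu hx h, hne12 _ _ hu hy h]
  have hxyW : s(x, y) ∈ W := Finset.mem_union_right _ hxyB
  have hxyU : s(x, y) ∉ edgesU F := fun h => (Finset.mem_filter.1 hxyB).2.2 (Or.inl (Or.inr h))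
  obtain ⟨l, hlW, hl1, hx2, hlU, hl, hluniq⟩ := hlegs x hx
  obtain ⟨m, hmW, hm1, hy2, hmU, hm, hmuniq⟩ := hlegs y hy
  have hlx := hne12 l x hl hx
  have hly := hne12 l y hl hy
  have hmx := hne12 m x hm hx
  have hmy := hne12 m y hm hy
  have hlm : l ≠ m := by
    rintro rfl
    exact hxyne (hmuniq x hlU)
  have hleaf : ∀ l z, s(l, z) ∈ W → (P.edges.filter (l ∈ ·)).card ≤ 1 →
      ∀ e ∈ W, l ∈ e → e = s(l, z) := by
    intro l z hlz hl e he hle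
    rw [← hWdeg] at hl
    exact Finset.card_le_one.1 hl _ (Finset.mem_filter.2 ⟨he, hle⟩) _
      (Finset.mem_filter.2 ⟨hlz, by simp⟩)
  have hmid : ∀ z e₁ e₂, e₁ ∈ W → e₂ ∈ W → e₁ ≠ e₂ → z ∈ e₁ → z ∈ e₂ →
      (P.edges.filter (z ∈ ·)).card ≤ 2 → ∀ e ∈ W, z ∈ e → e = e₁ ∨ e = e₂ := by
    intro z e₁ e₂ h1 h2 hne hz1 hz2 hz e he hze
    by_contra! hcon
    rw [← hWdeg] at hz
    have hsub : {e, e₁, e₂} ⊆ W.filter (z ∈ ·) := by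
      intro f hf
      simp only [Finset.mem_insert, Finset.mem_singleton] at hf
      rw [Finset.mem_filter]
      rcases hf with rfl | rfl | rfl
      exacts [⟨he, hze⟩, ⟨h1, hz1⟩, ⟨h2, hz2⟩]
    have h3 : ({e, e₁, e₂} : Finset (Sym2 V)).card = 3 :=
      Finset.card_eq_three.2 ⟨_, _, _, hcon.1, hcon.2, hne, rfl⟩
    have := Finset.card_le_card hsub
    omega
  let S : Set V := {v | v ∈ [l, x, y, m]}
  let W' := W.filter fun e => ∀ v ∈ e, v ∈ Sᶜ
  -- In `W` the leaves `l`, `m` have degree at most 1 and `x`, `y` degree at most 2, as in the path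
  -- system, so no further edge meets the path `l x y m`.
  have hWsub : W ⊆ W' ∪ {s(l, x), s(x, y), s(m, y)} := by
    intro e he
    by_cases h : ∀ v ∈ e, v ∈ Sᶜ
    · exact Finset.mem_union_left _ (Finset.mem_filter.2 ⟨he, h⟩)
    · apply Finset.mem_union_right
      push Not at h
      obtain ⟨v, hve, hv⟩ := h
      have hv : v ∈ [l, x, y, m] := by_contra hv
      simp only [List.mem_cons, List.not_mem_nil, or_false] at hv
      simp only [Finset.mem_insert, Finset.mem_singleton]
      rcases hv with rfl | rfl | rfl | rfl
      · exact Or.inl (hleaf _ _ hlW hl1 e he hve)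
      · have := hmid v _ _ hlW hxyW (fun h => hxyU (h ▸ hlU)) (by simp) (by simp) hx2 e he hve
        tauto
      · have := hmid v _ _ hmW hxyW (fun h => hxyU (h ▸ hmU)) (by simp) (by simp) hy2 e he hve
        tauto
      · exact Or.inr (Or.inr (hleaf _ _ hmW hm1 e he hve))
  have hW'card : 4 * Fintype.card A ≤ W'.card + 3 := by
    rw [← hWcard]
    exact (Finset.card_le_card hWsub).trans ((Finset.card_union_le _ _).trans
      (Nat.add_le_add_left Finset.card_le_three _))
  obtain ⟨p, q, hpq, hpair⟩ := PairOn.of_bipartite (G := G) Sᶜ W'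
    (fun e he => hWG e (Finset.mem_filter.1 he).1) (fun e he => (Finset.mem_filter.1 he).2) c'
    (fun x y he => hWc x y (Finset.mem_filter.1 he).1) (by
      intro v
      obtain ⟨a, i, rfl⟩ := hS.surj v
      refine (Finset.card_le_card (Finset.filter_subset_filter _ (Finset.filter_subset _ _))).trans
        ((hWdeg _).le.trans ((P.card_edges_filter_mem_le a i).trans ?_))
      revert i
      decide)
  have hpath := PairOn.path (G := G) [l, x, y, m]
    (by simp [hlx, hly, hlm, hxyne, hmx.symm, hmy.symm])
    (by
      simp only [List.isChain_cons_cons, List.isChain_singleton, and_true]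
      exact ⟨hWG _ hlW, hxyG, (show G.Adj m y from hWG _ hmW).symm⟩)
  -- The three-edge path splits as 2 + 1, and its larger half is added to either matching in turn.
  obtain ⟨H, H', hH, -, -, h1, h2⟩ := hpair.union hpath disjoint_compl_left
  obtain ⟨K, K', hK, -, -, k1, k2⟩ := hpair.symm.union hpath disjoint_compl_left
  have e1 := hB H H' hH
  have e2 := hB K K' hK
  simp only [List.length_cons, List.length_nil] at h1 h2 k1 k2
  omega

end PathSystem
end DisjointMatchings

namespace DisjointMatchings

/-! ### Matchings as involutions -/

/-- An involution exchanging the ends of the edges of a matching of `G`. -/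
structure IsMatchingFun {V : Type*} (G : SimpleGraph V) (h : V → V) : Prop where
  invol : ∀ v, h (h v) = v
  adj : ∀ v, h v ≠ v → G.Adj v (h v)

/-- The involution `h` exchanges the ends of the edges in `H`. -/
def Represents {V : Type*} (h : V → V) (H : Finset (Sym2 V)) : Prop :=
  ∀ v w, s(v, w) ∈ H ↔ h v = w ∧ v ≠ w

/-- A pair of disjoint matchings, as involutions. -/
structure IsMatchingFunPair {V : Type*} (G : SimpleGraph V) (h h' : V → V) : Prop where
  left : IsMatchingFun G h
  right : IsMatchingFun G h'
  disj : ∀ v, h v = h' v → h v = v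

section Representation

variable {V : Type*} {G : SimpleGraph V}

theorem IsMatchingOf.exists_fun {H : Finset (Sym2 V)} (hH : IsMatchingOf G H) :
    ∃ h, IsMatchingFun G h ∧ Represents h H := by
  classical
  let h : V → V := fun v => if hv : ∃ w, s(v, w) ∈ H then hv.choose else v
  have huniq : ∀ v w w', s(v, w) ∈ H → s(v, w') ∈ H → w = w' := by
    intro v w w' hw hw'
    by_contra hne
    refine hH.2 _ hw _ hw' (fun h => ?_) v (by simp) (by simp)
    rcases Sym2.eq_iff.1 h with ⟨-, h⟩ | ⟨h1, h2⟩
    exacts [hne h, hne (h2.trans h1)]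
  have hne : ∀ v w, s(v, w) ∈ H → v ≠ w := fun v w hw => (show G.Adj v w from hH.1 _ hw).ne
  have hrep : Represents h H := by
    intro v w
    constructor
    · intro hw
      have hv : ∃ w, s(v, w) ∈ H := ⟨w, hw⟩
      have : h v = hv.choose := dif_pos hv
      exact ⟨this.trans (huniq _ _ _ hv.choose_spec hw), hne v w hw⟩
    · rintro ⟨rfl, hvw⟩
      by_cases hv : ∃ w, s(v, w) ∈ H
      · have : h v = hv.choose := dif_pos hv
        rw [this]
        exact hv.choose_spec
      · have : h v = v := dif_neg hv
        exact (hvw this.symm).elim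
  refine ⟨h, ⟨fun v => ?_, fun v hv => hH.1 _ ((hrep _ _).2 ⟨rfl, hv.symm⟩)⟩, hrep⟩
  by_cases hv : h v = v
  · rw [hv, hv]
  · have := (hrep v (h v)).2 ⟨rfl, Ne.symm hv⟩
    rw [Sym2.eq_swap] at this
    exact ((hrep _ _).1 this).1

variable [Fintype V] [DecidableEq V]

/-- The vertices covered by a matching. -/
def moved (h : V → V) : Finset V := Finset.univ.filter fun v => h v ≠ v

theorem mem_moved {h : V → V} {v : V} : v ∈ moved h ↔ h v ≠ v := by
  simp [moved]

theorem IsMatchingFun.exists_finset {h : V → V} (hh : IsMatchingFun G h) :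
    ∃ H, IsMatchingOf G H ∧ Represents h H := by
  have hrep : Represents h ((moved h).image fun v => s(v, h v)) := by
    intro v w
    simp only [Finset.mem_image, mem_moved]
    constructor
    · rintro ⟨x, hx, hxv⟩
      rcases Sym2.eq_iff.1 hxv with ⟨rfl, rfl⟩ | ⟨rfl, rfl⟩
      · exact ⟨rfl, Ne.symm hx⟩
      · exact ⟨hh.invol _, hx⟩
    · rintro ⟨rfl, hvw⟩
      exact ⟨v, hvw.symm, rfl⟩
  refine ⟨_, ⟨fun e he => ?_, fun e he f hf hef v hv hv' => ?_⟩, hrep⟩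
  · obtain ⟨v, hv, rfl⟩ := Finset.mem_image.1 he
    exact hh.adj v (mem_moved.1 hv)
  · obtain ⟨w, rfl⟩ := hv
    obtain ⟨w', rfl⟩ := hv'
    exact hef (by rw [← ((hrep _ _).1 he).1, ← ((hrep _ _).1 hf).1])

theorem Represents.card_moved {h : V → V} {H : Finset (Sym2 V)} (hr : Represents h H) :
    (moved h).card = 2 * H.card := by
  have hmaps : ∀ v ∈ moved h, s(v, h v) ∈ H := fun v hv =>
    (hr _ _).2 ⟨rfl, (mem_moved.1 hv).symm⟩
  rw [Finset.card_eq_sum_card_fiberwise hmaps, Finset.sum_const_nat (m := 2), mul_comm]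
  intro e he
  induction e with
  | _ x y =>
    obtain ⟨h1, h2⟩ := (hr x y).1 he
    obtain ⟨h3, -⟩ := (hr y x).1 (Sym2.eq_swap ▸ he)
    rw [← Finset.card_pair h2]
    congr 1
    ext v
    simp only [Finset.mem_filter, mem_moved, Finset.mem_insert, Finset.mem_singleton, Sym2.eq_iff]
    constructor
    · rintro ⟨-, ⟨h, -⟩ | ⟨h, -⟩⟩
      exacts [Or.inl h, Or.inr h]
    · rintro (rfl | rfl)
      · exact ⟨by rw [h1]; exact h2.symm, Or.inl ⟨rfl, h1⟩⟩
      · exact ⟨by rw [h3]; exact h2, Or.inr ⟨rfl, h3⟩⟩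

theorem IsMatchingFunPair.exists_finsets {h h' : V → V} (hp : IsMatchingFunPair G h h') :
    ∃ H H', IsDisjointMatchingPair G H H' ∧ (moved h).card = 2 * H.card ∧
      (moved h').card = 2 * H'.card := by
  obtain ⟨H, hH, hr⟩ := hp.left.exists_finset
  obtain ⟨H', hH', hr'⟩ := hp.right.exists_finset
  refine ⟨H, H', ⟨hH, hH', ?_⟩, hr.card_moved, hr'.card_moved⟩
  rw [Finset.disjoint_left]
  intro e he he'
  induction e with
  | _ x y =>
    obtain ⟨h1, h2⟩ := (hr x y).1 he
    obtain ⟨h3, -⟩ := (hr' x y).1 he'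
    exact h2 ((hp.disj x (h1.trans h3.symm)).symm.trans h1)

theorem IsDisjointMatchingPair.exists_funs {H H' : Finset (Sym2 V)}
    (hp : IsDisjointMatchingPair G H H') :
    ∃ h h', IsMatchingFunPair G h h' ∧ (moved h).card = 2 * H.card ∧
      (moved h').card = 2 * H'.card := by
  obtain ⟨h, hh, hr⟩ := hp.1.exists_fun
  obtain ⟨h', hh', hr'⟩ := hp.2.1.exists_fun
  refine ⟨h, h', ⟨hh, hh', fun v hv => ?_⟩, hr.card_moved, hr'.card_moved⟩
  by_contra hne
  exact Finset.disjoint_left.1 hp.2.2 ((hr _ _).2 ⟨rfl, Ne.symm hne⟩)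
    ((hr' _ _).2 ⟨hv.symm, Ne.symm hne⟩)

end Representation

/-! ### Optimal pairs -/

section Optimal

variable {V : Type*} [DecidableEq V] {G : SimpleGraph V} {h h' m : V → V}

/-- Use `h'` on `S` and `h` outside `S`. -/
def swapOn (S : Finset V) (h h' : V → V) (v : V) : V := if v ∈ S then h' v else h v

theorem swapOn_of_mem {S : Finset V} {v : V} (hv : v ∈ S) : swapOn S h h' v = h' v := if_pos hv

theorem swapOn_of_notMem {S : Finset V} {v : V} (hv : v ∉ S) : swapOn S h h' v = h v := if_neg hv

theorem IsMatchingFun.swapOn (hh : IsMatchingFun G h) (hh' : IsMatchingFun G h') {S : Finset V}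
    (hS : ∀ v ∈ S, h v ∈ S) (hS' : ∀ v ∈ S, h' v ∈ S) : IsMatchingFun G (swapOn S h h') := by
  refine ⟨fun v => ?_, fun v hv => ?_⟩
  · by_cases hv : v ∈ S
    · rw [swapOn_of_mem hv, swapOn_of_mem (hS' v hv), hh'.invol]
    · have : h v ∉ S := fun hs => hv (hh.invol v ▸ hS _ hs)
      rw [swapOn_of_notMem hv, swapOn_of_notMem this, hh.invol]
  · by_cases hvS : v ∈ S
    · rw [swapOn_of_mem hvS] at hv ⊢
      exact hh'.adj v hv
    · rw [swapOn_of_notMem hvS] at hv ⊢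
      exact hh.adj v hv

theorem IsMatchingFunPair.swapOn (hp : IsMatchingFunPair G h h') {S : Finset V}
    (hS : ∀ v ∈ S, h v ∈ S) (hS' : ∀ v ∈ S, h' v ∈ S) :
    IsMatchingFunPair G (swapOn S h h') (swapOn S h' h) := by
  refine ⟨hp.left.swapOn hp.right hS hS', hp.right.swapOn hp.left hS' hS, fun v hv => ?_⟩
  by_cases hvS : v ∈ S
  · rw [swapOn_of_mem hvS, swapOn_of_mem hvS] at hv
    rw [swapOn_of_mem hvS, hv, hp.disj v hv.symm]
  · rw [swapOn_of_notMem hvS, swapOn_of_notMem hvS] at hv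
    rw [swapOn_of_notMem hvS, hp.disj v hv]

variable [Fintype V]

/-- A pair covering as many vertices as possible in total and, subject to this, having a first
member that covers as many vertices as possible. -/
structure IsOptimal (G : SimpleGraph V) (h h' : V → V) : Prop where
  pair : IsMatchingFunPair G h h'
  sum_le : ∀ k k', IsMatchingFunPair G k k' →
    (moved k).card + (moved k').card ≤ (moved h).card + (moved h').card
  le : ∀ k k', IsMatchingFunPair G k k' →
    (moved k).card + (moved k').card = (moved h).card + (moved h').card →
    (moved k).card ≤ (moved h).card

theorem IsOptimal.of_card_eq (hO : IsOptimal G h h') {k k' : V → V}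
    (hk : IsMatchingFunPair G k k') (h1 : (moved k).card = (moved h).card)
    (h2 : (moved k').card = (moved h').card) : IsOptimal G k k' :=
  ⟨hk, by rw [h1, h2]; exact hO.sum_le, by rw [h1, h2]; exact hO.le⟩

theorem card_moved_eq_add (h : V → V) (S : Finset V) :
    (moved h).card = (S.filter fun v => h v ≠ v).card + (Sᶜ.filter fun v => h v ≠ v).card := by
  rw [← Finset.card_union_of_disjoint (Finset.disjoint_filter_filter disjoint_compl_right),
    ← Finset.filter_union, Finset.union_compl, moved]

theorem card_moved_swapOn (h h' : V → V) (S : Finset V) :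
    (moved (swapOn S h h')).card =
      (S.filter fun v => h' v ≠ v).card + (Sᶜ.filter fun v => h v ≠ v).card := by
  rw [card_moved_eq_add _ S]
  congr 2
  · exact Finset.filter_congr fun v hv => by rw [swapOn_of_mem hv]
  · exact Finset.filter_congr fun v hv => by rw [swapOn_of_notMem (Finset.mem_compl.1 hv)]

/-- A closed set cannot contain a vertex missed by the first member of an optimal pair but none
missed by the second member. -/
theorem IsOptimal.false_of_closed (hO : IsOptimal G h h') {S : Finset V}
    (hS : ∀ v ∈ S, h v ∈ S) (hS' : ∀ v ∈ S, h' v ∈ S) {u : V} (hu : u ∈ S) (hhu : h u = u)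
    (hfix : ∀ v ∈ S, h' v ≠ v) : False := by
  have hp := hO.pair.swapOn hS hS'
  have e1 := card_moved_swapOn h h' S
  have e2 := card_moved_swapOn h' h S
  have e3 := card_moved_eq_add h S
  have e4 := card_moved_eq_add h' S
  have h1 : (S.filter fun v => h' v ≠ v) = S := Finset.filter_true_of_mem hfix
  have h2 : (S.filter fun v => h v ≠ v).card < S.card :=
    Finset.card_lt_card (Finset.filter_ssubset.2 ⟨u, hu, by simpa using hhu⟩)
  rw [h1] at e1 e4
  have := hO.le _ _ hp (by omega)
  omega

/-- When `S` contains exactly one vertex missed by each member, both members cover `S.card - 1`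
vertices of it, so the exchange changes neither size. It serves to interchange the roles of the two
ends of an alternating path. -/
theorem IsOptimal.swapOn (hO : IsOptimal G h h') {S : Finset V}
    (hS : ∀ v ∈ S, h v ∈ S) (hS' : ∀ v ∈ S, h' v ∈ S) {u w : V} (hu : u ∈ S) (hw : w ∈ S)
    (hhu : ∀ v ∈ S, h v = v ↔ v = u) (hhw : ∀ v ∈ S, h' v = v ↔ v = w) :
    IsOptimal G (swapOn S h h') (swapOn S h' h) := by
  have e1 := card_moved_swapOn h h' S
  have e2 := card_moved_swapOn h' h S
  have e3 := card_moved_eq_add h S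
  have e4 := card_moved_eq_add h' S
  have key : ∀ (k : V → V) (x : V), x ∈ S → (∀ v ∈ S, k v = v ↔ v = x) →
      (S.filter fun v => k v ≠ v).card = S.card - 1 := by
    intro k x hx hk
    rw [← Finset.card_erase_of_mem hx]
    congr 1
    ext v
    rw [Finset.mem_filter, Finset.mem_erase]
    constructor
    · exact fun hv => ⟨fun h => hv.2 ((hk v hv.1).2 h), hv.1⟩
    · exact fun hv => ⟨hv.2, fun h => hv.1 ((hk v hv.2).1 h)⟩
  rw [key h u hu hhu] at e2 e3
  rw [key h' w hw hhw] at e1 e4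
  exact hO.of_card_eq (hO.pair.swapOn hS hS') (by omega) (by omega)

/-- The vertices at which `m` agrees with one of `h` and `h'`. -/
def agree (m h h' : V → V) : Finset V :=
  Finset.univ.filter fun v => m v ≠ v ∧ (m v = h v ∨ m v = h' v)

theorem mem_agree {v : V} : v ∈ agree m h h' ↔ m v ≠ v ∧ (m v = h v ∨ m v = h' v) := by
  simp [agree]

theorem agree_swapOn (S : Finset V) : agree m (swapOn S h h') (swapOn S h' h) = agree m h h' := by
  ext v
  rw [mem_agree, mem_agree]
  by_cases hv : v ∈ S
  · rw [swapOn_of_mem hv, swapOn_of_mem hv, or_comm]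
  · rw [swapOn_of_notMem hv, swapOn_of_notMem hv]

/-- An optimal pair agreeing with `m` as often as possible. -/
structure IsBest (G : SimpleGraph V) (m h h' : V → V) : Prop where
  opt : IsOptimal G h h'
  le : ∀ k k', IsOptimal G k k' → (agree m k k').card ≤ (agree m h h').card

theorem IsOptimal.exists_isBest (hO : IsOptimal G h h') (m : V → V) :
    ∃ k k', IsBest G m k k' ∧ (moved k).card = (moved h).card := by
  have hne : {k : (V → V) × (V → V) | IsOptimal G k.1 k.2}.Nonempty := ⟨(h, h'), hO⟩
  obtain ⟨k, hk, hmax⟩ := Set.exists_max_image _ (fun k => (agree m k.1 k.2).card)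
    (Set.toFinite _) hne
  refine ⟨k.1, k.2, ⟨hk, fun l l' hl => hmax (l, l') hl⟩, ?_⟩
  have hs : (moved k.1).card + (moved k.2).card = (moved h).card + (moved h').card :=
    le_antisymm (hO.sum_le _ _ hk.pair) (hk.sum_le _ _ hO.pair)
  exact le_antisymm (hO.le _ _ hk.pair hs) (hk.le _ _ hO.pair hs.symm)

theorem IsBest.swapOn (hB : IsBest G m h h') {S : Finset V}
    (hS : ∀ v ∈ S, h v ∈ S) (hS' : ∀ v ∈ S, h' v ∈ S) {u w : V} (hu : u ∈ S) (hw : w ∈ S)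
    (hhu : ∀ v ∈ S, h v = v ↔ v = u) (hhw : ∀ v ∈ S, h' v = v ↔ v = w) :
    IsBest G m (swapOn S h h') (swapOn S h' h) :=
  ⟨hB.opt.swapOn hS hS' hu hw hhu hhw, by rw [agree_swapOn]; exact hB.le⟩

/-- In a best pair, an edge of `m` at a vertex missed by the first member belongs to the
second. -/
theorem IsBest.eq_of_fixed (hB : IsBest G m h h') (hm : IsMatchingFun G m) {u : V}
    (hu : h u = u) (hmu : m u ≠ u) : h' u = m u := by
  by_contra hne
  obtain ⟨hp, hsum, -⟩ := hB.opt
  set v := m u with hv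
  have hmv : m v = u := hm.invol u
  have hh := hp.left.invol
  have hh' := hp.right.invol
  have hh'v : h' v ≠ u := fun h => hne (by rw [← h, hh'])
  -- `k` is `h` with the edge `uv` of `m` added and the edge of `h` at `v`, if any, removed.
  let k : V → V := fun x => if x = u then v else if x = v then u else if x = h v then x else h x
  have ku : k u = v := if_pos rfl
  have kv : k v = u := by simp [k, hmu]
  have khv : h v ≠ v → k (h v) = h v := by
    intro hvv
    have : h v ≠ u := fun h1 => hmu (by rw [← hh v, h1, hu])
    simp [k, this, hvv]
  have kx : ∀ x, x ≠ u → x ≠ v → x ≠ h v → k x = h x := by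
    intro x h1 h2 h3
    simp [k, h1, h2, h3]
  have hk : IsMatchingFun G k := by
    constructor
    · intro x
      by_cases h1 : x = u
      · rw [h1, ku, kv]
      by_cases h2 : x = v
      · rw [h2, kv, ku]
      by_cases h3 : x = h v
      · have : h v ≠ v := fun h4 => h2 (h3.trans h4)
        rw [h3, khv this, khv this]
      · rw [kx x h1 h2 h3, kx (h x), hh]
        · exact fun h4 => h1 (by rw [← hh x, h4, hu])
        · exact fun h4 => h3 (by rw [← h4, hh])
        · exact fun h4 => h2 (by rw [← hh x, h4, hh])
    · intro x hx
      by_cases h1 : x = u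
      · rw [h1, ku]
        exact hm.adj u hmu
      by_cases h2 : x = v
      · rw [h2, kv]
        exact (hm.adj u hmu).symm
      by_cases h3 : x = h v
      · have : h v ≠ v := fun h4 => h2 (h3.trans h4)
        rw [h3, khv this] at hx
        exact (hx rfl).elim
      · rw [kx x h1 h2 h3] at hx ⊢
        exact hp.left.adj x hx
  have hpk : IsMatchingFunPair G k h' := by
    refine ⟨hk, hp.right, fun x hx => ?_⟩
    by_cases h1 : x = u
    · rw [h1, ku] at hx
      exact (hne hx.symm).elim
    by_cases h2 : x = v
    · rw [h2, kv] at hx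
      exact (hh'v hx.symm).elim
    by_cases h3 : x = h v
    · have : h v ≠ v := fun h4 => h2 (h3.trans h4)
      rw [h3, khv this]
    · rw [kx x h1 h2 h3] at hx ⊢
      exact hp.disj x hx
  have humoved : u ∉ moved h := fun h1 => mem_moved.1 h1 hu
  -- If `h` misses `v` as well, the total size grows. Otherwise all sizes are unchanged, but an edge
  -- of `m` is gained and none is lost, since `v` is matched by `m` to `u`.
  by_cases hvv : h v = v
  · have hsub : insert u (moved h) ⊆ moved k := by
      intro x hx
      rw [mem_moved]
      rcases Finset.mem_insert.1 hx with rfl | hx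
      · rw [ku]; exact hmu
      · rw [mem_moved] at hx
        have h1 : x ≠ u := fun h1 => hx (by rw [h1, hu])
        have h2 : x ≠ v := fun h1 => hx (by rw [h1, hvv])
        rwa [kx x h1 h2 (by rwa [hvv])]
    have := Finset.card_le_card hsub
    rw [Finset.card_insert_of_notMem humoved] at this
    have := hsum k h' hpk
    omega
  · have hvu : h v ≠ u := fun h1 => hmu (by rw [← hh v, h1, hu])
    have hmk : moved k = insert u ((moved h).erase (h v)) := by
      ext x
      rw [Finset.mem_insert, Finset.mem_erase, mem_moved, mem_moved]
      by_cases h1 : x = u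
      · subst h1
        simp [ku, hmu]
      by_cases h2 : x = v
      · subst h2
        simp [kv, Ne.symm hmu, hvv, Ne.symm hvv]
      by_cases h3 : x = h v
      · subst h3
        simp [khv hvv, hvu]
      · simp [kx x h1 h2 h3, h1, h3]
    have hcard : (moved k).card = (moved h).card := by
      have hmem : h v ∈ moved h := by rw [mem_moved, hh]; exact Ne.symm hvv
      rw [hmk, Finset.card_insert_of_notMem, Finset.card_erase_add_one hmem]
      exact fun h1 => humoved (Finset.mem_of_mem_erase h1)
    have hOk := hB.opt.of_card_eq hpk hcard rfl
    have hle := hB.le k h' hOk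
    have huA : u ∉ agree m h h' := by
      rw [mem_agree, hu]
      rintro ⟨-, h1 | h1⟩
      exacts [hmu h1, hne h1.symm]
    have hsub : insert u (agree m h h') ⊆ agree m k h' := by
      intro x hx
      rcases Finset.mem_insert.1 hx with rfl | hx
      · exact mem_agree.2 ⟨hmu, Or.inl ku.symm⟩
      · have h1 : x ≠ u := fun h1 => huA (h1 ▸ hx)
        obtain ⟨hx1, hx2⟩ := mem_agree.1 hx
        refine mem_agree.2 ⟨hx1, ?_⟩
        rcases hx2 with hx2 | hx2
        · have h2 : x ≠ v := by
            rintro rfl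
            exact hvu (hx2.symm.trans hmv)
          have h3 : x ≠ h v := by
            rintro rfl
            rw [hh] at hx2
            exact hvu (by rw [← hm.invol (h v), hx2, hmv])
          exact Or.inl (by rw [kx x h1 h2 h3, hx2])
        · exact Or.inr hx2
    have := Finset.card_le_card hsub
    rw [Finset.card_insert_of_notMem huA] at this
    omega

end Optimal
end DisjointMatchings

/-! ### Alternating paths issuing from vertices missed by the first matching. -/

namespace DisjointMatchings

variable {V : Type*} [DecidableEq V] {G : SimpleGraph V} {h h' m : V → V}

/-- `u` is covered by the second member of the pair but not by the first. -/
def IsStart (h h' : V → V) (u : V) : Prop := h u = u ∧ h' u ≠ u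

/-- The vertices at distance one to four from a start on its alternating path. -/
def tail (h h' : V → V) (u : V) : Finset V :=
  {h' u, h (h' u), h' (h (h' u)), h (h' (h (h' u)))}

variable [Fintype V]

/-- Otherwise the alternating path from `u` would be the single edge `{u, h' u}`, with both ends
missed by `h`: a closed set excluded by `false_of_closed`. The next lemma is the same with three
edges. -/
theorem IsOptimal.ne_of_isStart (hO : IsOptimal G h h') {u : V} (hu : IsStart h h' u) :
    h (h' u) ≠ h' u := by
  intro h1
  have hh' := hO.pair.right.invol
  have hu2 := hu.2
  refine hO.false_of_closed (S := {u, h' u}) ?_ ?_ (by simp) hu.1 ?_ <;>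
    simp only [Finset.mem_insert, Finset.mem_singleton] <;> rintro v (rfl | rfl) <;>
    simp [hu.1, h1, hh', hu2, Ne.symm hu2]

theorem IsOptimal.ne_of_isStart_of_ne (hO : IsOptimal G h h') {u : V} (hu : IsStart h h' u)
    (hne : h' (h (h' u)) ≠ h (h' u)) : h (h' (h (h' u))) ≠ h' (h (h' u)) := by
  intro h1
  have hh' := hO.pair.right.invol
  have hh := hO.pair.left.invol
  have hu2 := hu.2
  refine hO.false_of_closed (S := {u, h' u, h (h' u), h' (h (h' u))}) ?_ ?_ (by simp) hu.1 ?_ <;>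
    simp only [Finset.mem_insert, Finset.mem_singleton] <;> rintro v (rfl | rfl | rfl | rfl) <;>
    simp [hu.1, h1, hh', hu2, Ne.symm hu2, hh, hne, Ne.symm hne]

/-- If two tails met, either injectivity of the involutions would identify the starts, or one path
would run into another start. The latter yields an alternating path with both ends missed by `h` and
all vertices covered by `h'`, which `false_of_closed` excludes. -/
theorem IsOptimal.start_disjoint (hO : IsOptimal G h h') {u w : V} (hu : IsStart h h' u)
    (hw : IsStart h h' w) (huw : u ≠ w) : Disjoint (tail h h' u) (tail h h' w) := by
  have hh' := hO.pair.right.invol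
  have hh := hO.pair.left.invol
  have E1 : h' u ≠ h' w := fun h1 => huw (by rw [← hh' u, h1, hh'])
  have E2 : ∀ {u w}, IsStart h h' u → IsStart h h' w → h' u ≠ h (h' w) := by
    intro u w hu hw h1
    have h2 : h' (h (h' w)) = u := by rw [← h1, hh']
    refine hO.ne_of_isStart_of_ne hw ?_ ?_
    · rw [h2, ← h1]
      exact hu.2.symm
    · rw [h2, hu.1]
  have E3 : ∀ {u w}, IsStart h h' u → IsStart h h' w → h' u ≠ h' (h (h' w)) := by
    intro u w hu hw h1
    have h2 : u = h (h' w) := by rw [← hh' u, h1, hh']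
    apply hO.ne_of_isStart hw
    rw [← h2, ← hu.1, h2, hh]
  have E4 : ∀ {u w}, u ≠ w → IsStart h h' u → IsStart h h' w →
      h' u ≠ h (h' (h (h' w))) := by
    intro u w huw hu hw h1
    have E1 : h' u ≠ h' w := fun h1 => huw (by rw [← hh' u, h1, hh'])
    have h2 : h (h' u) = h' (h (h' w)) := by rw [h1, hh]
    have h3 : h' (h (h' w)) ≠ h (h' w) := fun h3 => E1 (by rw [h1, h3, hh])
    have hu2 := hu.2
    have hw2 := hw.2
    have h4 : h' (h (h' u)) = h (h' w) := by rw [h2, hh']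
    refine hO.false_of_closed (S := {u, h' u, h (h' u), h (h' w), h' w, w}) ?_ ?_ (by simp) hu.1 ?_ <;>
      simp only [Finset.mem_insert, Finset.mem_singleton] <;>
      rintro v (rfl | rfl | rfl | rfl | rfl | rfl) <;>
      simp [hu.1, hw.1, hh', hu2, Ne.symm hu2, hw2, Ne.symm hw2, hh, h3, Ne.symm h3, h2, ← h1]
  have E5 : h' (h (h' u)) ≠ h' (h (h' w)) := by
    intro h1
    apply E1
    rw [← hh (h' u), ← hh' (h (h' u)), h1, hh', hh]
  have E6 : h' (h (h' u)) ≠ h (h' (h (h' w))) := by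
    intro h1
    have h2 : h (h' (h (h' u))) = h' (h (h' w)) := by rw [h1, hh]
    have h3 : h' (h (h' u)) ≠ h (h' u) := by
      intro h3
      rw [h3, hh] at h2
      exact E3 hu hw h2
    have h4 : h' (h (h' w)) ≠ h (h' w) := by
      intro h4
      rw [h4, hh] at h1
      exact E3 hw hu h1.symm
    have hu2 := hu.2
    have hw2 := hw.2
    refine hO.false_of_closed
      (S := {u, h' u, h (h' u), h' (h (h' u)), h' (h (h' w)), h (h' w), h' w, w})
      ?_ ?_ (by simp) hu.1 ?_ <;>
      simp only [Finset.mem_insert, Finset.mem_singleton] <;>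
      rintro v (rfl | rfl | rfl | rfl | rfl | rfl | rfl | rfl) <;>
      simp [hu.1, hw.1, hh', hu2, Ne.symm hu2, hw2, Ne.symm hw2, hh, h4, h3, Ne.symm h3, h2,
        Ne.symm h4, ← h1]
  have E2a := E2 hu hw
  have E2b := E2 hw hu
  have E3a := E3 hu hw
  have E3b := E3 hw hu
  have E4a := E4 huw hu hw
  have E4b := E4 huw.symm hw hu
  -- `h` exchanges the first two and the last two vertices of each tail, so the sixteen coincidences
  -- reduce to those excluded above.
  have key : ∀ {x y}, h x = h y → x = y := fun {x y} h1 => by rw [← hh x, h1, hh]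
  rw [Finset.disjoint_left]
  intro x hx hx'
  simp only [tail, Finset.mem_insert, Finset.mem_singleton] at hx hx'
  rcases hx with rfl | rfl | rfl | rfl <;> rcases hx' with h1 | h1 | h1 | h1
  · exact E1 h1
  · exact E2a h1
  · exact E3a h1
  · exact E4a h1
  · exact E2b h1.symm
  · exact E1 (key h1)
  · exact E4a (by rw [← h1, hh])
  · exact E3a (key h1)
  · exact E3b h1.symm
  · exact E4b (by rw [h1, hh])
  · exact E5 h1
  · exact E6 h1
  · exact E4b h1.symm
  · exact E3b (key h1).symm
  · exact E6 (by rw [← h1, hh])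
  · exact E5 (key h1)

theorem IsOptimal.tail_subset_moved (hO : IsOptimal G h h') {u : V} (hu : IsStart h h' u) :
    tail h h' u ⊆ moved h := by
  have hh := hO.pair.left.invol
  have h1 := hO.ne_of_isStart hu
  intro x hx
  rw [mem_moved]
  simp only [tail, Finset.mem_insert, Finset.mem_singleton] at hx
  by_cases h3 : h' (h (h' u)) = h (h' u)
  · rw [h3, hh] at hx
    rcases hx with rfl | rfl | rfl | rfl
    · exact h1
    · rw [hh]; exact h1.symm
    · rw [hh]; exact h1.symm
    · exact h1
  · have h4 := hO.ne_of_isStart_of_ne hu h3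
    rcases hx with rfl | rfl | rfl | rfl
    · exact h1
    · rw [hh]; exact h1.symm
    · exact h4
    · rw [hh]; exact h4.symm

theorem IsOptimal.start_distinct (hO : IsOptimal G h h') {u : V} (hu : IsStart h h' u)
    (h3 : h' (h (h' u)) ≠ h (h' u)) :
    h' u ≠ h (h' u) ∧ h' u ≠ h' (h (h' u)) ∧ h' u ≠ h (h' (h (h' u))) ∧
      h (h' u) ≠ h' (h (h' u)) ∧ h (h' u) ≠ h (h' (h (h' u))) ∧
      h' (h (h' u)) ≠ h (h' (h (h' u))) := by
  have hh' := hO.pair.right.invol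
  have hh := hO.pair.left.invol
  have h1 := hO.ne_of_isStart hu
  have h13 : h' u ≠ h' (h (h' u)) := by
    intro h5
    have h6 := congrArg h' h5
    rw [hh', hh'] at h6
    have h7 := congrArg h h6
    rw [hh, hu.1] at h7
    exact hu.2 h7.symm
  refine ⟨h1.symm, h13, fun h5 => ?_, h3.symm, fun h5 => ?_, (hO.ne_of_isStart_of_ne hu h3).symm⟩
  · have h6 := congrArg h h5
    rw [hh] at h6
    exact h3 h6.symm
  · have h6 := congrArg h h5
    rw [hh, hh] at h6
    exact h13 h6

theorem IsOptimal.card_tail (hO : IsOptimal G h h') {u : V} (hu : IsStart h h' u) :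
    (tail h h' u).card = if h' (h (h' u)) = h (h' u) then 2 else 4 := by
  have hh := hO.pair.left.invol
  split_ifs with h3
  · have h1 := hO.ne_of_isStart hu
    rw [tail, h3, hh, ← Finset.card_pair h1.symm]
    congr 1
    ext x
    simp only [Finset.mem_insert, Finset.mem_singleton]
    tauto
  · obtain ⟨a1, a2, a3, a4, a5, a6⟩ := hO.start_distinct hu h3
    rw [tail, Finset.card_insert_of_notMem, Finset.card_insert_of_notMem,
      Finset.card_insert_of_notMem, Finset.card_singleton] <;> simp [*]

end DisjointMatchings

/-! ### The extremal case: a best pair yields a path system. -/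

namespace DisjointMatchings

section Structure

variable {V : Type*} [DecidableEq V] [Fintype V] {G : SimpleGraph V} {h h' m : V → V}

theorem IsBest.isStart (hB : IsBest G m h h') (hm : IsMatchingFun G m) {u : V}
    (hu : h u = u) (hmu : m u ≠ u) : IsStart h h' u :=
  ⟨hu, by rw [hB.eq_of_fixed hm hu hmu]; exact hmu⟩

/-- If the alternating path at a start has length two, then its other end is missed by `m`. -/
theorem IsBest.fixed_of_short (hB : IsBest G m h h') (hm : IsMatchingFun G m) {u : V}
    (hu : h u = u) (hmu : m u ≠ u) (hs : h' (h (h' u)) = h (h' u)) :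
    m (h (h' u)) = h (h' u) := by
  have hst := hB.isStart hm hu hmu
  have hh := hB.opt.pair.left.invol
  have hh' := hB.opt.pair.right.invol
  have h1 := hB.opt.ne_of_isStart hst
  have h2 : h' u ≠ u := hst.2
  have hmu' : h' u = m u := hB.eq_of_fixed hm hu hmu
  have h02 : h (h' u) ≠ u := fun h3 => h2 (by rw [← hh (h' u), h3, hu])
  have hB' := hB.swapOn (S := {u, h' u, h (h' u)}) (u := u) (w := h (h' u))
    (by simp only [Finset.mem_insert, Finset.mem_singleton]; rintro v (rfl | rfl | rfl) <;>
      simp [hu, hh])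
    (by simp only [Finset.mem_insert, Finset.mem_singleton]; rintro v (rfl | rfl | rfl) <;>
      simp [hs, hh'])
    (by simp) (by simp)
    (by simp only [Finset.mem_insert, Finset.mem_singleton]; rintro v (rfl | rfl | rfl) <;>
      simp [hu, hh, h1, h2, Ne.symm h1, h02])
    (by simp only [Finset.mem_insert, Finset.mem_singleton]; rintro v (rfl | rfl | rfl) <;>
      simp [hs, hh', h2, Ne.symm h2, Ne.symm h1, Ne.symm h02])
  by_contra hne
  have h3 := hB'.eq_of_fixed hm (u := h (h' u)) (by rw [swapOn_of_mem (by simp), hs]) hne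
  rw [swapOn_of_mem (by simp), hh, hmu'] at h3
  have h4 := congrArg m h3
  rw [hm.invol, hm.invol, ← hmu'] at h4
  exact h02 h4.symm

/-- The structure of a best pair when `m` is a quarter larger than its first member. -/
theorem IsBest.extremal (hB : IsBest G m h h') (hm : IsMatchingFun G m)
    (hcard : 4 * (moved m).card = 5 * (moved h).card) :
    (∀ w, h w ≠ w → m w ≠ w) ∧
    (∀ u, h u = u → m u ≠ u → h' (h (h' u)) ≠ h (h' u)) ∧
    (∀ x, h x ≠ x → ∃ u, h u = u ∧ m u ≠ u ∧ x ∈ tail h h' u) ∧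
    (moved h).card = 4 * (Finset.univ.filter fun u => h u = u ∧ m u ≠ u).card := by
  set A := Finset.univ.filter fun u => h u = u ∧ m u ≠ u with hA
  set B := Finset.univ.filter fun w => m w = w ∧ h w ≠ w with hBdef
  have hmemA : ∀ u, u ∈ A ↔ h u = u ∧ m u ≠ u := fun u => by simp [hA]
  have hstart : ∀ u ∈ A, IsStart h h' u := fun u hu =>
    hB.isStart hm ((hmemA u).1 hu).1 ((hmemA u).1 hu).2
  have hAB : A.card + (moved h).card = B.card + (moved m).card := by
    rw [← Finset.card_union_of_disjoint, ← Finset.card_union_of_disjoint]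
    · congr 1
      ext v
      simp only [hA, hBdef, Finset.mem_union, Finset.mem_filter, Finset.mem_univ, true_and,
        mem_moved]
      tauto
    · rw [Finset.disjoint_left]
      intro v hv
      simp only [hBdef, Finset.mem_filter, Finset.mem_univ, true_and, mem_moved] at hv ⊢
      tauto
    · rw [Finset.disjoint_left]
      intro v hv
      simp only [hA, Finset.mem_filter, Finset.mem_univ, true_and, mem_moved] at hv ⊢
      tauto
  have hdisj : ∀ u ∈ A, ∀ w ∈ A, u ≠ w → Disjoint (tail h h' u) (tail h h' w) :=
    fun u hu w hw huw => hB.opt.start_disjoint (hstart u hu) (hstart w hw) huw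
  set Sh := A.filter fun u => h' (h (h' u)) = h (h' u) with hSh
  -- The far end of a short path is covered by `h` but missed by `m`, and it determines the start.
  have hShB : Sh.card ≤ B.card := by
    refine Finset.card_le_card_of_injOn (fun u => h (h' u)) ?_ ?_
    · intro u hu
      obtain ⟨huA, hus⟩ := Finset.mem_filter.1 (Finset.mem_coe.1 hu)
      have := hB.opt.ne_of_isStart (hstart u huA)
      refine Finset.mem_coe.2 (Finset.mem_filter.2 ⟨Finset.mem_univ _,
        hB.fixed_of_short hm ((hmemA u).1 huA).1 ((hmemA u).1 huA).2 hus, ?_⟩)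
      rw [hB.opt.pair.left.invol]
      exact this.symm
    · intro u _ w _ huw
      have h1 := congrArg h huw
      simp only [hB.opt.pair.left.invol] at h1
      rw [← hB.opt.pair.right.invol u, h1, hB.opt.pair.right.invol]
  have hsub : A.biUnion (tail h h') ⊆ moved h := by
    intro x hx
    obtain ⟨u, hu, hx⟩ := Finset.mem_biUnion.1 hx
    exact hB.opt.tail_subset_moved (hstart u hu) hx
  have hcount : (A.biUnion (tail h h')).card + 2 * Sh.card = 4 * A.card := by
    rw [Finset.card_biUnion hdisj, hSh, Finset.card_filter, Finset.mul_sum,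
      ← Finset.sum_add_distrib, mul_comm, ← smul_eq_mul, ← Finset.sum_const]
    refine Finset.sum_congr rfl fun u hu => ?_
    rw [hB.opt.card_tail (hstart u hu)]
    split_ifs <;> rfl
  have hle := Finset.card_le_card hsub
  -- Disjoint tails give `4|A| - 2|Sh| ≤ |moved h|`. With `|A| = |B| + |moved m| - |moved h|` and
  -- `|Sh| ≤ |B|` this becomes `4|moved m| + 2|B| ≤ 5|moved h|`, so the assumed equality forces `B`
  -- to be empty.
  have hB0 : B = ∅ := Finset.card_eq_zero.1 (by omega)
  have hSh0 : Sh = ∅ := Finset.card_eq_zero.1 (by omega)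
  have hM : (moved h).card = 4 * A.card := by
    rw [hB0, Finset.card_empty] at hAB
    omega
  have heq : A.biUnion (tail h h') = moved h :=
    Finset.eq_of_subset_of_card_le hsub (by rw [hSh0, Finset.card_empty] at hcount; omega)
  refine ⟨fun w hw hmw => ?_, fun u hu hmu hs => ?_, fun x hx => ?_, hM⟩
  · have : w ∈ B := Finset.mem_filter.2 ⟨Finset.mem_univ _, hmw, hw⟩
    simp [hB0] at this
  · have : u ∈ Sh := Finset.mem_filter.2 ⟨(hmemA u).2 ⟨hu, hmu⟩, hs⟩
    simp [hSh0] at this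
  · rw [← mem_moved, ← heq, Finset.mem_biUnion] at hx
    obtain ⟨u, hu, hx⟩ := hx
    exact ⟨u, ((hmemA u).1 hu).1, ((hmemA u).1 hu).2, hx⟩

/-- In the extremal case the vertices covered by a best pair form a path system. -/
theorem IsBest.exists_pathSystem (hB : IsBest G m h h') (hm : IsMatchingFun G m)
    (hcard : 4 * (moved m).card = 5 * (moved h).card) :
    ∃ A : Finset V, Nonempty (PathSystem G A) ∧ (moved h).card = 4 * A.card := by
  obtain ⟨hsat, hlong, hcov, hM⟩ := hB.extremal hm hcard
  set A := Finset.univ.filter fun u => h u = u ∧ m u ≠ u with hA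
  have hmemA : ∀ u, u ∈ A ↔ h u = u ∧ m u ≠ u := fun u => by simp [hA]
  have hstart : ∀ u ∈ A, IsStart h h' u := fun u hu =>
    hB.isStart hm ((hmemA u).1 hu).1 ((hmemA u).1 hu).2
  have hh := hB.opt.pair.left.invol
  have hh' := hB.opt.pair.right.invol
  have hmm := hm.invol
  have hdisj : ∀ u ∈ A, ∀ w ∈ A, ∀ x, x ∈ tail h h' u → x ∈ tail h h' w → u = w := by
    intro u hu w hw x hx hx'
    by_contra huw
    exact Finset.disjoint_left.1 (hB.opt.start_disjoint (hstart u hu) (hstart w hw) huw) hx hx'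
  have ht1 : ∀ u, h' u ∈ tail h h' u := fun u => by simp [tail]
  have ht2 : ∀ u, h (h' u) ∈ tail h h' u := fun u => by simp [tail]
  have ht3 : ∀ u, h' (h (h' u)) ∈ tail h h' u := fun u => by simp [tail]
  have ht4 : ∀ u, h (h' (h (h' u))) ∈ tail h h' u := fun u => by simp [tail]
  have htm : ∀ u ∈ A, ∀ x ∈ tail h h' u, h x ≠ x := fun u hu x hx =>
    mem_moved.1 (hB.opt.tail_subset_moved (hstart u hu) hx)
  have hdist : ∀ u ∈ A, _ := fun u hu =>
    hB.opt.start_distinct (hstart u hu) (hlong u ((hmemA u).1 hu).1 ((hmemA u).1 hu).2)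
  have hAne : ∀ u ∈ A, ∀ w ∈ A, ∀ x ∈ tail h h' w, u ≠ x := by
    rintro u hu w hw x hx rfl
    exact htm w hw u hx ((hmemA u).1 hu).1
  -- the last vertex of a path is missed by `h'`
  have hend : ∀ u ∈ A, h' (h (h' (h (h' u)))) = h (h' (h (h' u))) := by
    intro u hu
    by_contra hne
    obtain ⟨d12, d13, d14, d23, d24, d34⟩ := hdist u hu
    have hu1 := ((hmemA u).1 hu).1
    have hu2 := (hstart u hu).2
    set y := h' (h (h' (h (h' u)))) with hy
    have hy' : h' y = h (h' (h (h' u))) := by rw [hy, hh']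
    -- Suppose the path continues to `y`. If `h` misses `y`, a six-vertex path with both ends missed
    -- by `h` results. Otherwise `y` lies in some tail: its first three positions contradict
    -- disjointness or distinctness, and the last gives a ten-vertex path between two starts.
    by_cases hfix : h y = y
    · refine hB.opt.false_of_closed
        (S := {u, h' u, h (h' u), h' (h (h' u)), h (h' (h (h' u))), y}) ?_ ?_ (by simp) hu1 ?_ <;>
        simp only [Finset.mem_insert, Finset.mem_singleton] <;>
        rintro v (rfl | rfl | rfl | rfl | rfl | rfl) <;>
        simp [hu1, hh, hh', hu2, Ne.symm hu2, d23, Ne.symm d23, hfix, hne, Ne.symm hne, ← hy,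
          hy']
    · obtain ⟨w, hw1, hw2, hyw⟩ := hcov y hfix
      have hw : w ∈ A := (hmemA w).2 ⟨hw1, hw2⟩
      have hw2' := (hstart w hw).2
      simp only [tail, Finset.mem_insert, Finset.mem_singleton] at hyw
      rcases hyw with h1 | h1 | h1 | h1
      · rw [h1, hh'] at hy'
        exact hAne w hw u hu _ (ht4 u) hy'
      · rw [h1] at hy'
        obtain rfl := hdisj u hu w hw _ (ht4 u) (hy' ▸ ht3 w)
        exact d34 hy'
      · rw [h1, hh'] at hy'
        obtain rfl := hdisj u hu w hw _ (ht4 u) (hy' ▸ ht2 w)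
        exact d24 hy'
      · obtain ⟨e12, e13, e14, e23, e24, e34⟩ := hdist w hw
        have hhy : h y = h' (h (h' w)) := by rw [h1, hh]
        refine hB.opt.false_of_closed
          (S := {u, h' u, h (h' u), h' (h (h' u)), h (h' (h (h' u))), y, h' (h (h' w)), h (h' w),
            h' w, w}) ?_ ?_ (by simp) hu1 ?_ <;>
          simp only [Finset.mem_insert, Finset.mem_singleton] <;>
          rintro v (rfl | rfl | rfl | rfl | rfl | hv | rfl | rfl | rfl | rfl) <;>
          (try subst hv) <;>
          simp [hu1, hw1, hh, hh', hu2, Ne.symm hu2, hw2', Ne.symm hw2', d23, Ne.symm d23, e23,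
            Ne.symm e23, hne, Ne.symm hne, ← hy, hy', ← h1, hhy]
  -- the last edge of a path belongs to `m`
  have hlast : ∀ u ∈ A, m (h (h' (h (h' u)))) = h' (h (h' u)) := by
    intro u hu
    obtain ⟨d12, d13, d14, d23, d24, d34⟩ := hdist u hu
    have hu1 := ((hmemA u).1 hu).1
    have hu2 := (hstart u hu).2
    have he := hend u hu
    have n2 := hAne u hu u hu _ (ht2 u)
    have n3 := hAne u hu u hu _ (ht3 u)
    have n4 := hAne u hu u hu _ (ht4 u)
    -- After exchanging the matchings along the whole path, its last vertex is the one missed by the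
    -- first member; `eq_of_fixed` then applies at that end.
    have hB' := hB.swapOn (S := {u, h' u, h (h' u), h' (h (h' u)), h (h' (h (h' u)))}) (u := u)
      (w := h (h' (h (h' u))))
      (by simp only [Finset.mem_insert, Finset.mem_singleton]
          rintro v (rfl | rfl | rfl | rfl | rfl) <;> simp [hu1, hh])
      (by simp only [Finset.mem_insert, Finset.mem_singleton]
          rintro v (rfl | rfl | rfl | rfl | rfl) <;> simp [he, hh'])
      (by simp) (by simp)
      (by simp only [Finset.mem_insert, Finset.mem_singleton]
          rintro v (rfl | rfl | rfl | rfl | rfl) <;>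
            simp [hu1, hh, hu2, d12, Ne.symm d12, d34, Ne.symm d34, Ne.symm n2, Ne.symm n3,
              Ne.symm n4])
      (by simp only [Finset.mem_insert, Finset.mem_singleton]
          rintro v (rfl | rfl | rfl | rfl | rfl) <;>
            simp [he, hh', hu2, Ne.symm hu2, d14, d23, Ne.symm d23, d24, d34, n4])
    have h1 := hB'.eq_of_fixed hm (u := h (h' (h (h' u))))
      (by rw [swapOn_of_mem (by simp), he]) (hsat _ (by rw [hh]; exact d34))
    rw [← h1, swapOn_of_mem (by simp), hh]
  -- `m` joins the centres of the paths
  have hcentre : ∀ u : A, ∃ w : A, m (h (h' u.1)) = h (h' w.1) := by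
    rintro ⟨u, hu⟩
    obtain ⟨d12, d13, d14, d23, d24, d34⟩ := hdist u hu
    have hmoved : m (h (h' u)) ≠ h (h' u) := hsat _ (htm u hu _ (ht2 u))
    have hmz := hmm (h (h' u))
    generalize m (h (h' u)) = z at hmz hmoved ⊢
    -- `m` matches each start to the first tail vertex and the third tail vertex to the fourth. The
    -- partner `z` of a centre is none of these, so it is a centre.
    have hzmoved : h z ≠ z := by
      intro hfix
      have hzA : z ∈ A := (hmemA z).2 ⟨hfix, fun h1 => hmoved (h1.symm.trans hmz)⟩
      have h1 : h' z = h (h' u) :=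
        (hB.eq_of_fixed hm hfix ((hmemA z).1 hzA).2).trans hmz
      obtain rfl := hdisj z hzA u hu _ (ht1 z) (h1 ▸ ht2 u)
      exact d12 h1
    obtain ⟨w, hw1, hw2, hzw⟩ := hcov z hzmoved
    have hw : w ∈ A := (hmemA w).2 ⟨hw1, hw2⟩
    refine ⟨⟨w, hw⟩, ?_⟩
    simp only [tail, Finset.mem_insert, Finset.mem_singleton] at hzw
    rcases hzw with h1 | h1 | h1 | h1
    · rw [h1, hB.eq_of_fixed hm hw1 hw2, hmm] at hmz
      exact (hAne w hw u hu _ (ht2 u) hmz).elim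
    · exact h1
    · rw [h1, ← hlast w hw, hmm] at hmz
      obtain rfl := hdisj u hu w hw _ (ht2 u) (hmz ▸ ht4 w)
      exact (d24 hmz.symm).elim
    · rw [h1, hlast w hw] at hmz
      obtain rfl := hdisj u hu w hw _ (ht2 u) (hmz ▸ ht3 w)
      exact (d23 hmz.symm).elim
  choose τ hτ using hcentre
  have hτeq : ∀ u w : A, h (h' u.1) = h (h' w.1) → u = w := fun u w huw =>
    Subtype.ext (hdisj u u.2 w w.2 _ (ht2 u) (huw ▸ ht2 w))
  have hadj := hB.opt.pair.left.adj
  have hadj' := hB.opt.pair.right.adj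
  refine ⟨A, ⟨⟨fun u => ![u, h' u, h (h' u), h' (h (h' u)), h (h' (h (h' u)))], τ, ?_, ?_, ?_,
    ?_, ?_, ?_, ?_, ?_⟩⟩, hM⟩
  · rintro ⟨u, hu⟩ ⟨w, hw⟩ i j hij
    have huw : u = w := by
      have hi : ∀ u : V, ∀ i : Fin 5, i ≠ 0 →
          ![u, h' u, h (h' u), h' (h (h' u)), h (h' (h (h' u)))] i ∈ tail h h' u := by
        intro u i hi
        fin_cases i <;> simp [tail] at hi ⊢
      by_cases hi0 : i = 0 <;> by_cases hj0 : j = 0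
      · subst hi0 hj0
        exact hij
      · subst hi0
        exact (hAne u hu w hw _ (hi w j hj0) hij).elim
      · subst hj0
        exact (hAne w hw u hu _ (hi u i hi0) hij.symm).elim
      · exact hdisj u hu w hw _ (hi u i hi0) (by simpa [← hij] using hi w j hj0)
    subst huw
    refine ⟨rfl, ?_⟩
    obtain ⟨d12, d13, d14, d23, d24, d34⟩ := hdist u hu
    have n1 := hAne u hu u hu _ (ht1 u)
    have n2 := hAne u hu u hu _ (ht2 u)
    have n3 := hAne u hu u hu _ (ht3 u)
    have n4 := hAne u hu u hu _ (ht4 u)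
    have hnd : [u, h' u, h (h' u), h' (h (h' u)), h (h' (h (h' u)))].Nodup := by
      simp [*]
    have := List.nodup_iff_injective_get.1 hnd (a₁ := i) (a₂ := j)
    apply this
    revert hij
    fin_cases i <;> fin_cases j <;> exact id
  · intro u
    apply hτeq
    rw [← hτ, ← hτ, hmm]
  · intro u hu
    have h1 := hτ u
    rw [hu] at h1
    exact hsat _ (htm u u.2 _ (ht2 u)) h1
  · exact fun u => hadj' u (hstart u u.2).2
  · exact fun u => hadj _ (htm u u.2 _ (ht1 u))
  · exact fun u => hadj' _ (hdist u u.2).2.2.2.1.symm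
  · exact fun u => hadj _ (htm u u.2 _ (ht3 u))
  · intro u
    have := hm.adj _ (hsat _ (htm u u.2 _ (ht2 u)))
    rw [hτ] at this
    exact this

end Structure
end DisjointMatchings

/-! ### Attainment of β, λ and α, and the conclusion. -/

namespace DisjointMatchings

section Parameters

variable {V : Type*} (G : SimpleGraph V)

theorem isMatchingOf_empty : IsMatchingOf G ∅ := by simp [IsMatchingOf]

variable {G} in
theorem IsDisjointMatchingPair.symm {H H' : Finset (Sym2 V)}
    (h : IsDisjointMatchingPair G H H') : IsDisjointMatchingPair G H' H :=
  ⟨h.2.1, h.1, h.2.2.symm⟩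

variable [Finite V]

theorem card_le_natCard_sym2 (H : Finset (Sym2 V)) : H.card ≤ Nat.card (Sym2 V) := by
  classical
  have := Fintype.ofFinite V
  rw [Nat.card_eq_fintype_card]
  exact Finset.card_le_univ H

theorem exists_card_eq_beta : ∃ H, IsMatchingOf G H ∧ H.card = beta G := by
  obtain ⟨H, hH, h⟩ := Nat.sSup_mem (s := {n | ∃ H, IsMatchingOf G H ∧ n = H.card})
    ⟨0, ∅, isMatchingOf_empty G, rfl⟩
    ⟨Nat.card (Sym2 V), by rintro _ ⟨H, -, rfl⟩; exact card_le_natCard_sym2 H⟩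
  exact ⟨H, hH, h.symm⟩

theorem bddAbove_pairs :
    BddAbove {n | ∃ H H', IsDisjointMatchingPair G H H' ∧ n = H.card + H'.card} :=
  ⟨Nat.card (Sym2 V) + Nat.card (Sym2 V), by
    rintro _ ⟨H, H', -, rfl⟩
    exact Nat.add_le_add (card_le_natCard_sym2 H) (card_le_natCard_sym2 H')⟩

variable {G} in
theorem IsDisjointMatchingPair.card_add_card_le_lam {H H' : Finset (Sym2 V)}
    (h : IsDisjointMatchingPair G H H') : H.card + H'.card ≤ lam G :=
  le_csSup (bddAbove_pairs G) ⟨H, H', h, rfl⟩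

theorem exists_card_add_card_eq_lam :
    ∃ H H', IsDisjointMatchingPair G H H' ∧ H.card + H'.card = lam G := by
  obtain ⟨H, H', hH, h⟩ := Nat.sSup_mem
    (s := {n | ∃ H H', IsDisjointMatchingPair G H H' ∧ n = H.card + H'.card})
    ⟨0, ∅, ∅, ⟨isMatchingOf_empty G, isMatchingOf_empty G, disjoint_bot_left⟩, rfl⟩
    (bddAbove_pairs G)
  exact ⟨H, H', hH, h.symm⟩

theorem bddAbove_alpha :
    BddAbove {n | ∃ H H', IsDisjointMatchingPair G H H' ∧ H.card + H'.card = lam G ∧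
      (n = H.card ∨ n = H'.card)} :=
  ⟨Nat.card (Sym2 V), by
    rintro _ ⟨H, H', -, -, rfl | rfl⟩
    exacts [card_le_natCard_sym2 H, card_le_natCard_sym2 H']⟩

variable {G} in
theorem IsDisjointMatchingPair.card_le_alpha {H H' : Finset (Sym2 V)}
    (h : IsDisjointMatchingPair G H H') (hs : H.card + H'.card = lam G) : H.card ≤ alpha G :=
  le_csSup (bddAbove_alpha G) ⟨H, H', h, hs, Or.inl rfl⟩

theorem exists_card_eq_alpha :
    ∃ H H', IsDisjointMatchingPair G H H' ∧ H.card + H'.card = lam G ∧ H.card = alpha G := by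
  obtain ⟨H₀, H₀', h₀, hs₀⟩ := exists_card_add_card_eq_lam G
  obtain ⟨H, H', hH, hs, h⟩ := Nat.sSup_mem
    (s := {n | ∃ H H', IsDisjointMatchingPair G H H' ∧ H.card + H'.card = lam G ∧
      (n = H.card ∨ n = H'.card)}) ⟨_, H₀, H₀', h₀, hs₀, Or.inl rfl⟩ (bddAbove_alpha G)
  rcases h with h | h
  · exact ⟨H, H', hH, hs, h.symm⟩
  · exact ⟨H', H, hH.symm, by rw [add_comm, hs], h.symm⟩

end Parameters

theorem PathSystem.card_eq {V A : Type*} [Fintype V] [Fintype A] {G : SimpleGraph V}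
    (P : PathSystem G A) (hP : ∀ v, ∃ a i, v = P.φ a i) :
    Fintype.card V = 5 * Fintype.card A := by
  have hbij : Function.Bijective fun x : A × Fin 5 => P.φ x.1 x.2 := by
    refine ⟨fun x y h => Prod.ext (P.inj _ _ _ _ h).1 (P.inj _ _ _ _ h).2, fun v => ?_⟩
    obtain ⟨a, i, h⟩ := hP v
    exact ⟨(a, i), h.symm⟩
  rw [← Fintype.card_of_bijective hbij, Fintype.card_prod, Fintype.card_fin, mul_comm]

theorem exists_pathSystem_of_four_mul_beta_eq {V : Type*} [Finite V] (G : SimpleGraph V)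
    (h : 4 * beta G = 5 * alpha G) :
    ∃ A : Finset V, Nonempty (PathSystem G A) ∧ alpha G = 2 * A.card ∧ Balanced G A.card := by
  classical
  have := Fintype.ofFinite V
  obtain ⟨H, H', hH, hs, ha⟩ := exists_card_eq_alpha G
  obtain ⟨k, k', hk, hkc, hkc'⟩ := hH.exists_funs
  obtain ⟨M, hM, hMc⟩ := exists_card_eq_beta G
  obtain ⟨m, hm, hr⟩ := hM.exists_fun
  have hO : IsOptimal G k k' := by
    refine ⟨hk, fun l l' hl => ?_, fun l l' hl hsum => ?_⟩
    · obtain ⟨L, L', hL, h1, h2⟩ := hl.exists_finsets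
      have := hL.card_add_card_le_lam
      omega
    · obtain ⟨L, L', hL, h1, h2⟩ := hl.exists_finsets
      have := hL.card_le_alpha (by omega)
      omega
  obtain ⟨l, l', hB, hl⟩ := hO.exists_isBest m
  obtain ⟨A, hA, hAc⟩ := hB.exists_pathSystem hm (by rw [hr.card_moved, hMc, hl, hkc, ha]; omega)
  -- Both members of a pair attaining λ have size at most α, so λ ≤ 2α = 4|A|. A pair of total at
  -- least 4|A| therefore attains λ, and its members have size at most α = 2|A|.
  refine ⟨A, hA, by omega, fun L L' hL hsum => ?_⟩
  have h1 := hL.card_add_card_le_lam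
  have h2 := hH.symm.card_le_alpha (by omega)
  have h3 := hL.card_le_alpha (by omega)
  omega

end DisjointMatchings

theorem mainTheorem3 {V : Type*} [Finite V] (G : SimpleGraph V)
    (hG : ∀ v, ∃ w, G.Adj v w)
    (hratio : (DisjointMatchings.beta G : ℚ) / (DisjointMatchings.alpha G : ℚ) = 5 / 4) :
    DisjointMatchings.IsSGraph G ∧
    ∀ F : SimpleGraph V, DisjointMatchings.IsSpanningSForest G F →
      (Nat.card F.ConnectedComponent : ℤ) =
        (DisjointMatchings.beta G : ℤ) - (DisjointMatchings.alpha G : ℤ) ∧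
      DisjointMatchings.ConditionA G F ∧
      DisjointMatchings.ConditionB G F ∧
      DisjointMatchings.ConditionC G F := by
  classical
  have := Fintype.ofFinite V
  have h45 : 4 * DisjointMatchings.beta G = 5 * DisjointMatchings.alpha G := by
    -- Division by zero yields 0, which differs from 5/4.
    have hα : (DisjointMatchings.alpha G : ℚ) ≠ 0 := by
      intro h
      rw [h, div_zero] at hratio
      norm_num at hratio
    rw [div_eq_div_iff hα (by norm_num)] at hratio
    have : (4 * DisjointMatchings.beta G : ℚ) = 5 * DisjointMatchings.alpha G := by linarith
    exact_mod_cast this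
  obtain ⟨A, ⟨P⟩, hα, hB⟩ := DisjointMatchings.exists_pathSystem_of_four_mul_beta_eq G h45
  have hPs := P.φ_surjective (by rwa [Fintype.card_coe]) hG
  have hPc := P.card_eq hPs
  rw [Fintype.card_coe] at hPc
  refine ⟨P.isSGraph hPs, fun F hF => ?_⟩
  obtain ⟨Q, hQ⟩ := hF.exists_pathSystem
  have : Fintype F.ConnectedComponent := Fintype.ofFinite _
  have hQc := Q.card_eq hQ.surj
  -- Both systems cover `V` with five vertices per path, so they have equally many paths and balance
  -- transfers to `F`. Each component holds two paths, whence α is four times and β five times the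
  -- number of components.
  have hcard : Fintype.card (F.ConnectedComponent × Bool) = A.card := by omega
  have hB' : DisjointMatchings.Balanced G (Fintype.card (F.ConnectedComponent × Bool)) := by
    rwa [hcard]
  refine ⟨?_, hQ.conditionA hB' hG, hQ.conditionB hB' hG, hQ.conditionC hB'⟩
  rw [Fintype.card_prod, Fintype.card_bool] at hcard
  rw [Nat.card_eq_fintype_card]
  omega
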